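/- \textbf{Setting.} Let $k\ge 1$ and let $a_1,\dots,a_k,b_1,\dots,b_k\in\mathbb{R}$. Let $\mathbf{T}(f)$ be the symmetric tridiagonal $k$-Toeplitz operator on $\ell^2(\mathbb{N})$ (complex sequences) whose diagonal is the $k$-periodic repetition of $a_1,\dots,a_k$ and whose sub- and superdiagonal are the $k$-periodic repetition of $b_1,\dots,b_k$. Its symbol is $f(z)=\mathbf{A}_{-1}z^{-1}+\mathbf{A}_0+\mathbf{A}_1z\in\mathbb{C}^{k\times k}$, where $\mathbf{A}_0$ is the symmetric tridiagonal matrix with diagonal $a_1,\dots,a_k$ and off-diagonal $b_1,\dots,b_{k-1}$, the only non-zero entry of $\mathbf{A}_{-1}$ is $(\mathbf{A}_{-1})_{k,1}=b_k$, and the only non-zero entry of $\mathbf{A}_1$ is $(\mathbf{A}_1)_{1,k}=b_k$. Call such an $f$ an \emph{admissible symbol} if (1) $b_1,\dots,b_{k-1}$ are all non-zero, and (2) $f$ is \emph{persymmetric} (local inversion symmetry): $f(z)=\mathbf{J}f(z)^{\top}\mathbf{J}$ for all $z\ne0$, with $\mathbf{J}_{i,j}=\delta_{i,k+1-j}$.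 Let $\mathbf{B}_0=\mathbf{B}_0(f)$ be the leading $(k-1)\times(k-1)$ principal submatrix of $\mathbf{A}_0$, and let $\sigma_{\mathrm{ess}}(\mathbf{T}(f))$ be the set of $\lambda\in\mathbb{C}$ for which $\mathbf{T}(f)-\lambda$ is not a Fredholm operator. An \emph{edge eigenvalue} of $\mathbf{T}(f)$ is a number $\lambda\notin\sigma_{\mathrm{ess}}(\mathbf{T}(f))$ for which $\mathbf{T}(f)\mathbf{v}=\lambda\mathbf{v}$ has a non-zero, exponentially decaying solution $\mathbf{v}\in\ell^2(\mathbb{N})$. For $|z|=1$ let $\lambda_1(f(z))\le\dots\le\lambda_k(f(z))$ be the eigenvalues of the Hermitian matrix $f(z)$. For $1\le j<k$ the $j$-th \emph{band gap} of $f$ is the open interval $$I_j(f)=\Bigl(\max_{|z|=1}\lambda_j(f(z)),\ \min_{|z|=1}\lambda_{j+1}(f(z))\Bigr),$$ and it is \emph{closed} if this interval is empty. \textbf{Theorem.} Let $f$ be an admissible symbol. Then every $\lambda\in\sigma(\mathbf{B}_0(f))\setminus\sigma_{\mathrm{ess}}(\mathbf{T}(f))$ is topologically protected, in the following sense. There is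 $j\in\{1,\dots,k-1\}$ with $\lambda\in I_j(f)$ such that the following holds for every family $(f_t)_{t\in[0,1]}$ of admissible symbols with $f_0=f$, with coefficients depending continuously on $t$, and with $I_j(f_t)\neq\emptyset$ for all $t\in[0,1]$. There is a unique continuous function $\mu:[0,1]\to\mathbb{C}$ with $\mu(0)=\lambda$ and $\mu(t)\in\sigma(\mathbf{B}_0(f_t))$ for all $t\in[0,1]$. Moreover, for every $t\in[0,1]$, (i) $\mu(t)\notin\sigma_{\mathrm{ess}}(\mathbf{T}(f_t))$ and $\mu(t)\in I_j(f_t)$; (ii) $\mu(t)$ is an edge eigenvalue of $\mathbf{T}(f_t)$ if and only if $\lambda$ is an edge eigenvalue of $\mathbf{T}(f)$. -/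

import Mathlib

open scoped ENNReal

noncomputable section

namespace TriToeplitz

/-- Real coefficients of a symmetric tridiagonal `k`-Toeplitz operator: the diagonal entries
`a₁, …, a_k` and the off-diagonal entries `b₁, …, b_k` (with `c_i = b_i`), indexed from `0`.
The last off-diagonal entry `b_k` couples neighbouring unit cells. -/
structure RealSymbol (k : ℕ) where
  a : Fin k → ℝ
  b : Fin k → ℝ

variable {k : ℕ}

namespace RealSymbol

/-- The diagonal block `A₀`. -/
def A0 (S : RealSymbol k) : Matrix (Fin k) (Fin k) ℂ :=
  Matrix.of fun i j =>
    if i = j then (S.a i : ℂ)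
    else if (i : ℕ) + 1 = j then (S.b i : ℂ)
    else if (j : ℕ) + 1 = i then (S.b j : ℂ)
    else 0

/-- The block `A₋₁` above the diagonal: its only non-zero entry is `b_k`, in the lower left
corner. -/
def Aneg (S : RealSymbol k) : Matrix (Fin k) (Fin k) ℂ :=
  Matrix.of fun i j => if (i : ℕ) + 1 = k ∧ (j : ℕ) = 0 then (S.b i : ℂ) else 0

/-- The block `A₁` below the diagonal: its only non-zero entry is `c_k = b_k`, in the upper right
corner. -/
def Apos (S : RealSymbol k) : Matrix (Fin k) (Fin k) ℂ :=
  Matrix.of fun i j => if (i : ℕ) = 0 ∧ (j : ℕ) + 1 = k then (S.b j : ℂ) else 0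

/-- The symbol `f(z) = A₋₁ z⁻¹ + A₀ + A₁ z`. -/
def symbol (S : RealSymbol k) (z : ℂ) : Matrix (Fin k) (Fin k) ℂ :=
  z⁻¹ • S.Aneg + S.A0 + z • S.Apos

/-- The leading `(k-1) × (k-1)` principal submatrix `B₀` of `A₀`. -/
def B0 (S : RealSymbol k) : Matrix (Fin (k - 1)) (Fin (k - 1)) ℂ :=
  S.A0.submatrix (Fin.castLE (Nat.sub_le k 1)) (Fin.castLE (Nat.sub_le k 1))

/-- The exchange matrix. -/
def exchange (k : ℕ) : Matrix (Fin k) (Fin k) ℂ :=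
  Matrix.of fun i j => if j = i.rev then 1 else 0

/-- Persymmetry of the symbol (local inversion symmetry): `f(z) = J f(z)ᵀ J`. -/
def Persymmetric (S : RealSymbol k) : Prop :=
  ∀ z : ℂ, z ≠ 0 → S.symbol z = exchange k * (S.symbol z).transpose * exchange k

/-- The couplings `b₁, …, b_{k-1}` inside the unit cell do not vanish. -/
def Nondegenerate (S : RealSymbol k) : Prop :=
  ∀ i : Fin k, (i : ℕ) + 1 < k → S.b i ≠ 0

/-! ### The Toeplitz operator on `ℓ²(ℕ)` -/

/-- The complex Hilbert space `ℓ²(ℕ)`. -/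
abbrev L2 : Type := lp (fun _ : ℕ => ℂ) 2

/-- The action of the semi-infinite tridiagonal matrix with the `k`-periodic diagonal `a` and the
`k`-periodic off-diagonals `b` on a sequence. -/
def toeplitzFun [NeZero k] (S : RealSymbol k) (x : ℕ → ℂ) (n : ℕ) : ℂ :=
  (S.a (Fin.ofNat k n) : ℂ) * x n + (S.b (Fin.ofNat k n) : ℂ) * x (n + 1) +
    (if n = 0 then 0 else (S.b (Fin.ofNat k (n - 1)) : ℂ) * x (n - 1))

theorem memlp_periodic_mul [NeZero k] (c : Fin k → ℝ) {x : ℕ → ℂ}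
    (hx : Memℓp (E := fun _ : ℕ => ℂ) x 2) :
    Memℓp (E := fun _ : ℕ => ℂ) (fun n => (c (Fin.ofNat k n) : ℂ) * x n) 2 := by
  have h2 : 0 < (2 : ℝ≥0∞).toReal := by norm_num
  rw [memℓp_gen_iff h2] at hx ⊢
  simp only [ENNReal.toReal_ofNat, Real.rpow_ofNat] at hx ⊢
  refine Summable.of_nonneg_of_le (fun n => by positivity) (fun n => ?_)
    (hx.mul_left (∑ i, ‖(c i : ℂ)‖ ^ 2))
  rw [norm_mul, mul_pow]
  gcongr
  exact Finset.single_le_sum (f := fun i => ‖(c i : ℂ)‖ ^ 2) (fun i _ => by positivity)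
    (Finset.mem_univ (Fin.ofNat k n))

theorem memlp_toeplitzFun [NeZero k] (S : RealSymbol k) {x : ℕ → ℂ}
    (hx : Memℓp (E := fun _ : ℕ => ℂ) x 2) :
    Memℓp (E := fun _ : ℕ => ℂ) (S.toeplitzFun x) 2 := by
  have h2 : 0 < (2 : ℝ≥0∞).toReal := by norm_num
  have ha := memlp_periodic_mul S.a hx
  have hs : Memℓp (E := fun _ : ℕ => ℂ) (fun n => x (n + 1)) 2 := by
    rw [memℓp_gen_iff h2] at hx ⊢
    exact (summable_nat_add_iff 1).mpr hx
  have hb := memlp_periodic_mul S.b hs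
  have hl : Memℓp (E := fun _ : ℕ => ℂ) (fun n => if n = 0 then (0 : ℂ) else
      (S.b (Fin.ofNat k (n - 1)) : ℂ) * x (n - 1)) 2 := by
    have h := memlp_periodic_mul S.b hx
    rw [memℓp_gen_iff h2] at h ⊢
    rw [← summable_nat_add_iff 1]
    simpa using h
  exact (ha.add hb).add hl

/-- The action of `T(f)` as a linear map on `ℓ²(ℕ)`. -/
def toeplitzLin [NeZero k] (S : RealSymbol k) : L2 →ₗ[ℂ] L2 where
  toFun x := ⟨S.toeplitzFun x, S.memlp_toeplitzFun (lp.memℓp x)⟩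
  map_add' x y := by
    ext n
    simp only [toeplitzFun, lp.coeFn_add, Pi.add_apply]
    split_ifs <;> ring
  map_smul' c x := by
    ext n
    simp only [toeplitzFun, lp.coeFn_smul, Pi.smul_apply, smul_eq_mul, RingHom.id_apply]
    split_ifs <;> ring

/-- The Toeplitz operator `T(f)` as a bounded operator on `ℓ²(ℕ)`. -/
def toeplitz [NeZero k] (S : RealSymbol k) : L2 →L[ℂ] L2 :=
  ContinuousLinearMap.ofSeqClosedGraph (g := S.toeplitzLin) (by
    intro u x y hu hgu
    have hev : ∀ n : ℕ, Continuous (fun v : L2 => v n) := fun n =>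
      (lp.evalCLM ℂ (fun _ : ℕ => ℂ) 2 n).continuous
    ext n
    have h1 := ((hev n).tendsto y).comp hgu
    have hc : Continuous (fun v : L2 => S.toeplitzFun v n) := by
      unfold toeplitzFun
      split_ifs
      · exact ((continuous_const.mul (hev n)).add (continuous_const.mul (hev (n + 1)))).add
          continuous_const
      · exact ((continuous_const.mul (hev n)).add (continuous_const.mul (hev (n + 1)))).add
          (continuous_const.mul (hev (n - 1)))
    exact tendsto_nhds_unique h1 ((hc.tendsto x).comp hu))

theorem toeplitz_apply [NeZero k] (S : RealSymbol k) (x : L2) (n : ℕ) :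
    S.toeplitz x n = S.toeplitzFun x n := rfl

/-- The essential spectrum `σ_ess(T(f))`: all `lam` such that `T(f) - lam` is not Fredholm. -/
def essSpectrum [NeZero k] (S : RealSymbol k) : Set ℂ :=
  {lam | ¬ (S.toeplitz - lam • ContinuousLinearMap.id ℂ L2).IsFredholm}

/-- `lam` is an edge eigenvalue of `T(f)`: it lies outside the essential spectrum and has an
exponentially decaying eigenvector in `ℓ²(ℕ)`. -/
def IsEdgeEigenvalue [NeZero k] (S : RealSymbol k) (lam : ℂ) : Prop :=
  lam ∉ S.essSpectrum ∧ ∃ v : L2, v ≠ 0 ∧ S.toeplitz v = lam • v ∧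
    ∃ C q : ℝ, 0 < q ∧ q < 1 ∧ ∀ n : ℕ, ‖v n‖ ≤ C * q ^ n

/-! ### Bands and gaps -/

theorem symbol_isHermitian (S : RealSymbol k) (z : Circle) : (S.symbol z).IsHermitian := by
  have hz : (starRingEnd ℂ) (z : ℂ) = (z : ℂ)⁻¹ := (Circle.coe_inv_eq_conj z).symm
  ext i j
  simp only [symbol, A0, Aneg, Apos, Matrix.conjTranspose_apply, Matrix.add_apply,
    Matrix.smul_apply, Matrix.of_apply, smul_eq_mul, star_add, star_mul', RCLike.star_def,
    map_inv₀, hz, inv_inv, apply_ite (starRingEnd ℂ), Complex.conj_ofReal, map_zero]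
  by_cases h : i = j
  · subst h
    simp only [if_true, and_comm]
    ring
  · have h1 : ¬ j = i := fun e => h e.symm
    have h2 : ¬ ((i : ℕ) + 1 = j ∧ (j : ℕ) + 1 = i) := by omega
    simp only [h, h1, if_false, and_comm]
    split_ifs <;> first | (exfalso; omega) | ring

/-- The band functions `λ₁(f(z)) ≤ … ≤ λ_k(f(z))`, `|z| = 1`: the eigenvalues of the Hermitian
matrix `f(z)` in increasing order, with multiplicity (indexed from `0`). -/
def bandFun (S : RealSymbol k) (j : Fin k) (z : Circle) : ℝ :=
  (S.symbol_isHermitian z).eigenvalues₀ (Fin.cast (Fintype.card_fin k).symm j.rev)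

/-- The `j`-th band gap: the open interval between the top of the `j`-th spectral band
`{λ_j(f(z)) : |z| = 1}` and the bottom of the next one. As the unit circle is compact, it is empty
exactly if `max λ_j ≥ min λ_{j+1}`, that is, if the gap is closed. -/
def gap (S : RealSymbol k) (j : ℕ) (hj : j + 1 < k) : Set ℝ :=
  {x | ∀ z w : Circle, S.bandFun ⟨j, by omega⟩ z < x ∧ x < S.bandFun ⟨j + 1, hj⟩ w}

/-- `lam` is topologically protected: it lies in a band gap, and under every continuous deformation
`F` of the symbol (within the real symmetric symbols with non-vanishing couplings in the unit cell)
that preserves local inversion symmetry and keeps this band gap open, `lam` continues in one and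
only one way to a continuous path of eigenvalues of `B₀`; this path never meets the essential
spectrum, stays in the band gap, and is an edge eigenvalue of the deformed operator as long as
(and only if) `lam` is an edge eigenvalue of the original one. -/
def TopologicallyProtected [NeZero k] (S : RealSymbol k) (lam : ℂ) : Prop :=
  ∃ (j : ℕ) (hj : j + 1 < k), lam ∈ Complex.ofReal '' S.gap j hj ∧
    ∀ F : unitInterval → RealSymbol k,
      (Continuous fun t => (F t).a) → (Continuous fun t => (F t).b) → F 0 = S →
      (∀ t, (F t).Nondegenerate) → (∀ t, (F t).Persymmetric) →
      (∀ t, ((F t).gap j hj).Nonempty) →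
      ∃ μ : C(unitInterval, ℂ), μ 0 = lam ∧
        (∀ t, μ t ∈ spectrum ℂ (F t).B0 \ (F t).essSpectrum ∧
          μ t ∈ Complex.ofReal '' (F t).gap j hj ∧
          ((F t).IsEdgeEigenvalue (μ t) ↔ S.IsEdgeEigenvalue lam)) ∧
        ∀ ν : C(unitInterval, ℂ), ν 0 = lam → (∀ t, ν t ∈ spectrum ℂ (F t).B0) → ν = μ

end RealSymbol

end TriToeplitz

end

/-! ### Variational bounds for the sorted eigenvalues of symmetric operators. -/

section SymmetricEigenvalues

open Module InnerProductSpace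

variable {E F : Type*} [NormedAddCommGroup E] [InnerProductSpace ℂ E] [FiniteDimensional ℂ E]
  [NormedAddCommGroup F] [InnerProductSpace ℂ F] [FiniteDimensional ℂ F]

namespace LinearMap.IsSymmetric

/-! Number the sites of a cell from 0 and let u = `sol β` solve the three-term recurrence inside one
cell with u₀ = 1. As the couplings inside the cell are nonzero, the eigenvalues β of B₀ are simple,
and each satisfies u_{k-1} = 0. Two numbers then decide everything: α = `innerCoupling` and γ = b_k
= `outerCoupling`. With e the unit vector of the last site, f(z)u = βu + (α + γ/z)e
(`symbol_mulVec_solVec`), and β is an eigenvalue of some f(z) with |z| = 1 exactly if |α| = |γ|.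

On the half-line, for γ ≠ 0, repeating u from cell to cell with multiplier q = -α/γ solves the
eigenvalue equation, boundary row included (`bloch_rec`). If |α| < |γ| it decays and is an edge
state. If |α| > |γ|, then T(f) - β is bounded below and has no kernel. In both cases it is bounded
below on {x₀ = 0}, hence Fredholm by symmetry. If |α| = |γ|, truncated Bloch waves show that it is
not Fredholm (`not_isFredholm_shifted`).

Cauchy interlacing puts each eigenvalue of B₀ weakly between two consecutive bands. If it touches
one of them at z, persymmetry supplies a second eigenvector of f(z), the reversal of u; both
neighbouring band functions then equal β at z and the gap is closed
(`symbolEigenvalue_eq_of_contact`). So an open gap keeps |α| ≠ |γ| along the deformation, and by the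
intermediate value theorem the sign of |γ| - |α|, which detects the edge state, never changes. The
eigenvalues of B₀ move continuously by Weyl's inequality and stay distinct, so the path is unique.
-/

theorem eigenvalues_congr {T : E →ₗ[ℂ] E} (hT : T.IsSymmetric) {n m : ℕ}
    (hn : finrank ℂ E = n) (hm : finrank ℂ E = m) {i : Fin n} {j : Fin m}
    (hij : (i : ℕ) = j) : hT.eigenvalues hn i = hT.eigenvalues hm j := by
  subst hn hm
  rw [Fin.ext hij]

/-- The quadratic form of a symmetric operator in an eigenbasis. -/
theorem re_inner_eq_sum {T : E →ₗ[ℂ] E} (hT : T.IsSymmetric) {n : ℕ}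
    (hn : finrank ℂ E = n) (x : E) :
    (⟪T x, x⟫_ℂ).re =
      ∑ i, hT.eigenvalues hn i * ‖⟪hT.eigenvectorBasis hn i, x⟫_ℂ‖ ^ 2 := by
  rw [← (hT.eigenvectorBasis hn).sum_inner_mul_inner (T x) x, Complex.re_sum]
  refine Finset.sum_congr rfl fun i _ => ?_
  rw [hT, hT.apply_eigenvectorBasis, inner_smul_right, ← inner_conj_symm x, mul_assoc,
    mul_comm ((starRingEnd ℂ) _), Complex.mul_conj, Complex.normSq_eq_norm_sq]
  simp [← Complex.ofReal_mul, -Complex.ofReal_pow]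

theorem finrank_span_eigenvectorBasis {T : E →ₗ[ℂ] E} (hT : T.IsSymmetric) {n : ℕ}
    (hn : finrank ℂ E = n) (s : Finset (Fin n)) :
    finrank ℂ (Submodule.span ℂ (hT.eigenvectorBasis hn '' (s : Set (Fin n)))) = s.card := by
  have hli : LinearIndependent ℂ (hT.eigenvectorBasis hn) :=
    (hT.eigenvectorBasis hn).orthonormal.linearIndependent
  have h := finrank_span_eq_card (hli.comp ((↑) : s → Fin n) Subtype.coe_injective)
  rw [Set.range_comp, Subtype.range_coe_subtype] at h
  simpa using h

theorem inner_eq_zero_of_mem_span {T : E →ₗ[ℂ] E} (hT : T.IsSymmetric) {n : ℕ}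
    (hn : finrank ℂ E = n) {s : Finset (Fin n)} {x : E}
    (hx : x ∈ Submodule.span ℂ (hT.eigenvectorBasis hn '' (s : Set (Fin n)))) {i : Fin n}
    (hi : i ∉ s) : ⟪hT.eigenvectorBasis hn i, x⟫_ℂ = 0 := by
  induction hx using Submodule.span_induction with
  | mem x hx =>
    obtain ⟨j, hj, rfl⟩ := hx
    exact (hT.eigenvectorBasis hn).orthonormal.2 fun h => hi (h ▸ hj)
  | zero => simp
  | add x y _ _ hx hy => rw [inner_add_right, hx, hy, add_zero]
  | smul c x _ hx => rw [inner_smul_right, hx, mul_zero]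

/-- A subspace of dimension `i + 1` on which the form is bounded below by the `i`-th eigenvalue. -/
theorem exists_submodule_eigenvalue_le {T : E →ₗ[ℂ] E} (hT : T.IsSymmetric) {n : ℕ}
    (hn : finrank ℂ E = n) (i : Fin n) :
    ∃ V : Submodule ℂ E, finrank ℂ V = i + 1 ∧
      ∀ x ∈ V, hT.eigenvalues hn i * ‖x‖ ^ 2 ≤ (⟪T x, x⟫_ℂ).re := by
  -- Eigenvalues are sorted decreasingly, so the first `i + 1` eigenvectors span the right space.
  refine ⟨_, (hT.finrank_span_eigenvectorBasis hn (Finset.Iic i)).trans (by simp), fun x hx => ?_⟩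
  rw [hT.re_inner_eq_sum hn, ← (hT.eigenvectorBasis hn).sum_sq_norm_inner_right x, Finset.mul_sum]
  refine Finset.sum_le_sum fun j _ => ?_
  by_cases hj : j ≤ i
  · exact mul_le_mul_of_nonneg_right (hT.eigenvalues_antitone hn hj) (sq_nonneg _)
  · rw [hT.inner_eq_zero_of_mem_span hn hx (by simpa using hj)]
    simp

/-- A lower bound of the form on a subspace of dimension at least `i + 1` bounds the `i`-th
eigenvalue from below. -/
theorem le_eigenvalue_of_submodule {T : E →ₗ[ℂ] E} (hT : T.IsSymmetric) {n : ℕ}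
    (hn : finrank ℂ E = n) (i : Fin n) (V : Submodule ℂ E) (hV : (i : ℕ) + 1 ≤ finrank ℂ V)
    {c : ℝ} (hc : ∀ x ∈ V, c * ‖x‖ ^ 2 ≤ (⟪T x, x⟫_ℂ).re) : c ≤ hT.eigenvalues hn i := by
  set W := Submodule.span ℂ (hT.eigenvectorBasis hn '' (Finset.Ici i : Finset (Fin n))) with hW
  have hWdim : finrank ℂ W = n - i :=
    (hT.finrank_span_eigenvectorBasis hn (Finset.Ici i)).trans (by simp)
  have hdim := Submodule.finrank_sup_add_finrank_inf_eq V W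
  have hle : finrank ℂ ↥(V ⊔ W) ≤ n := hn ▸ Submodule.finrank_le _
  -- The dimensions, at least `i + 1` and exactly `n - i`, add up to more than `n`, so the two
  -- spaces meet.
  have hpos : 0 < finrank ℂ ↥(V ⊓ W) := by have := i.2; omega
  obtain ⟨x, hx, hx0⟩ := Submodule.exists_mem_ne_zero_of_ne_bot (p := V ⊓ W) fun h => by
    rw [h, finrank_bot] at hpos
    exact lt_irrefl _ hpos
  have hup : (⟪T x, x⟫_ℂ).re ≤ hT.eigenvalues hn i * ‖x‖ ^ 2 := by
    rw [hT.re_inner_eq_sum hn, ← (hT.eigenvectorBasis hn).sum_sq_norm_inner_right x,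
      Finset.mul_sum]
    refine Finset.sum_le_sum fun j _ => ?_
    by_cases hj : i ≤ j
    · exact mul_le_mul_of_nonneg_right (hT.eigenvalues_antitone hn hj) (sq_nonneg _)
    · rw [hT.inner_eq_zero_of_mem_span hn hx.2 (by simpa using hj)]
      simp
  have hpos' : 0 < ‖x‖ ^ 2 := by positivity
  exact le_of_mul_le_mul_right ((hc x hx.1).trans hup) hpos'

/-- Weyl's inequality. -/
theorem eigenvalues_le_add {T R : E →ₗ[ℂ] E} (hT : T.IsSymmetric) (hR : R.IsSymmetric) {n : ℕ}
    (hn : finrank ℂ E = n) (i : Fin n) {ε : ℝ}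
    (h : ∀ x, (⟪T x, x⟫_ℂ).re ≤ (⟪R x, x⟫_ℂ).re + ε * ‖x‖ ^ 2) :
    hT.eigenvalues hn i ≤ hR.eigenvalues hn i + ε := by
  obtain ⟨V, hV, hVT⟩ := hT.exists_submodule_eigenvalue_le hn i
  have := hR.le_eigenvalue_of_submodule hn i V hV.ge (c := hT.eigenvalues hn i - ε)
    fun x hx => by linarith [hVT x hx, h x]
  linarith

/-- Sorted eigenvalues are Lipschitz in the operator norm. -/
theorem abs_eigenvalues_sub_le {T R : E →L[ℂ] E} (hT : (T : E →ₗ[ℂ] E).IsSymmetric)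
    (hR : (R : E →ₗ[ℂ] E).IsSymmetric) {n : ℕ} (hn : finrank ℂ E = n) (i : Fin n) :
    |hT.eigenvalues hn i - hR.eigenvalues hn i| ≤ ‖T - R‖ := by
  have key : ∀ (A B : E →L[ℂ] E) (x : E),
      (⟪A x, x⟫_ℂ).re ≤ (⟪B x, x⟫_ℂ).re + ‖A - B‖ * ‖x‖ ^ 2 := fun A B x => by
    have h1 : (⟪(A - B) x, x⟫_ℂ).re ≤ ‖A - B‖ * ‖x‖ ^ 2 :=
      calc (⟪(A - B) x, x⟫_ℂ).re ≤ ‖⟪(A - B) x, x⟫_ℂ‖ := Complex.re_le_norm _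
        _ ≤ ‖(A - B) x‖ * ‖x‖ := norm_inner_le_norm _ _
        _ ≤ (‖A - B‖ * ‖x‖) * ‖x‖ := by gcongr; exact (A - B).le_opNorm x
        _ = _ := by ring
    rw [show (A - B) x = A x - B x from rfl, inner_sub_left, Complex.sub_re] at h1
    linarith
  have h1 := hT.eigenvalues_le_add hR hn i (key T R)
  have h2 := hR.eigenvalues_le_add hT hn i (key R T)
  rw [norm_sub_rev] at h2
  rw [abs_le]
  constructor <;> linarith

/-- Cauchy interlacing, upper half. -/
theorem eigenvalues_compression_le {T : E →ₗ[ℂ] E} {R : F →ₗ[ℂ] F} (hT : T.IsSymmetric)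
    (hR : R.IsSymmetric) {n m : ℕ} (hn : finrank ℂ E = n) (hm : finrank ℂ F = m)
    (e : F →ₗᵢ[ℂ] E) (he : ∀ y, ⟪T (e y), e y⟫_ℂ = ⟪R y, y⟫_ℂ) {i : Fin m} {j : Fin n}
    (hij : (j : ℕ) = i) : hR.eigenvalues hm i ≤ hT.eigenvalues hn j := by
  obtain ⟨V, hV, hVR⟩ := hR.exists_submodule_eigenvalue_le hm i
  refine hT.le_eigenvalue_of_submodule hn j (V.map e.toLinearMap) ?_ ?_
  · rw [← (Submodule.equivMapOfInjective e.toLinearMap e.injective V).finrank_eq, hV, hij]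
  · rintro _ ⟨y, hy, rfl⟩
    simpa [he] using hVR y hy

/-- Cauchy interlacing, lower half, for a compression to a hyperplane. -/
theorem eigenvalues_le_compression {T : E →ₗ[ℂ] E} {R : F →ₗ[ℂ] F} (hT : T.IsSymmetric)
    (hR : R.IsSymmetric) {n m : ℕ} (hn : finrank ℂ E = n) (hm : finrank ℂ F = m)
    (hnm : n ≤ m + 1)
    (e : F →ₗᵢ[ℂ] E) (he : ∀ y, ⟪T (e y), e y⟫_ℂ = ⟪R y, y⟫_ℂ) {i : Fin m} {j : Fin n}
    (hij : (j : ℕ) = i + 1) : hT.eigenvalues hn j ≤ hR.eigenvalues hm i := by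
  obtain ⟨V, hV, hVT⟩ := hT.exists_submodule_eigenvalue_le hn j
  refine hR.le_eigenvalue_of_submodule hm i (V.comap e.toLinearMap) ?_ ?_
  -- `V` has dimension `i + 2`; meeting the range of `e`, of codimension at most one, leaves at
  -- least `i + 1`.
  · have h1 : finrank ℂ ((V.comap e.toLinearMap).map e.toLinearMap) =
        finrank ℂ (V.comap e.toLinearMap) := by
      exact (Submodule.equivMapOfInjective e.toLinearMap e.injective _).finrank_eq.symm
    rw [Submodule.map_comap_eq] at h1
    have h2 := Submodule.finrank_sup_add_finrank_inf_eq e.toLinearMap.range V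
    have h3 : finrank ℂ ↥(e.toLinearMap.range ⊔ V) ≤ n := hn ▸ Submodule.finrank_le _
    have h4 : finrank ℂ e.toLinearMap.range = m := by
      rw [LinearMap.finrank_range_of_inj e.injective, hm]
    omega
  · intro y hy
    simpa [he] using hVT (e y) hy

end LinearMap.IsSymmetric

end SymmetricEigenvalues

noncomputable section

namespace TriToeplitz

namespace RealSymbol

/-! ### Sequences in `ℓ²(ℕ)`: residue classes and shifts -/

section Sequences

theorem L2.summable_sq (x : L2) : Summable fun n => ‖x n‖ ^ 2 := by
  have h := (memℓp_gen_iff (p := 2) (by norm_num)).mp (lp.memℓp x)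
  simpa using h

theorem memlp_of_summable_sq {x : ℕ → ℂ} (h : Summable fun n => ‖x n‖ ^ 2) :
    Memℓp (E := fun _ : ℕ => ℂ) x 2 :=
  (memℓp_gen_iff (p := 2) (by norm_num)).mpr (by simpa using h)

theorem L2.norm_sq (x : L2) : ‖x‖ ^ 2 = ∑' n, ‖x n‖ ^ 2 := by
  have h := lp.norm_rpow_eq_tsum (p := 2) (by norm_num) x
  simpa using h

theorem L2.norm_le_norm {x y : L2} (h : ∑' n, ‖x n‖ ^ 2 ≤ ∑' n, ‖y n‖ ^ 2) : ‖x‖ ≤ ‖y‖ := by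
  rw [← L2.norm_sq, ← L2.norm_sq] at h
  exact (sq_le_sq₀ (norm_nonneg _) (norm_nonneg _)).mp h

/-- The subsequence of `x` along the residue class of `i` modulo `k`. -/
def cell (k : ℕ) [NeZero k] (x : L2) (i : ℕ) : L2 :=
  ⟨fun n => x (k * n + i), memlp_of_summable_sq <| (L2.summable_sq x).comp_injective
    (i := fun n => k * n + i) fun m n h => by simpa [NeZero.ne k] using h⟩

/-- The right shift. -/
def shiftR (x : L2) : L2 :=
  ⟨fun n => if n = 0 then 0 else x (n - 1), memlp_of_summable_sq <| by
    rw [← summable_nat_add_iff 1]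
    simpa using L2.summable_sq x⟩

/-- The left shift. -/
def shiftL (x : L2) : L2 :=
  ⟨fun n => x (n + 1), memlp_of_summable_sq <|
    (summable_nat_add_iff (f := fun n => ‖x n‖ ^ 2) 1).mpr (L2.summable_sq x)⟩

variable {k : ℕ} [NeZero k]

@[simp] theorem cell_apply (x : L2) (i n : ℕ) : cell k x i n = x (k * n + i) := rfl

@[simp] theorem shiftR_apply (x : L2) (n : ℕ) :
    shiftR x n = if n = 0 then 0 else x (n - 1) := rfl

@[simp] theorem shiftL_apply (x : L2) (n : ℕ) : shiftL x n = x (n + 1) := rfl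

/-- The index of `cell` is not reduced modulo `k`: index `k` is the first site of the next cell. -/
theorem cell_add_period (x : L2) : cell k x k = shiftL (cell k x 0) := by
  ext n
  simp [mul_add]

theorem norm_shiftR (x : L2) : ‖shiftR x‖ = ‖x‖ := by
  have h : ‖shiftR x‖ ^ 2 = ‖x‖ ^ 2 := by
    rw [L2.norm_sq, L2.norm_sq, (L2.summable_sq (shiftR x)).tsum_eq_zero_add]
    simp
  exact (sq_eq_sq₀ (norm_nonneg _) (norm_nonneg _)).mp h

theorem norm_shiftL_sq (x : L2) : ‖x‖ ^ 2 = ‖x 0‖ ^ 2 + ‖shiftL x‖ ^ 2 := by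
  rw [L2.norm_sq, L2.norm_sq, (L2.summable_sq x).tsum_eq_zero_add]
  rfl

theorem norm_shiftL_le (x : L2) : ‖shiftL x‖ ≤ ‖x‖ :=
  (sq_le_sq₀ (norm_nonneg _) (norm_nonneg _)).mp <| by
    rw [norm_shiftL_sq x]
    exact le_add_of_nonneg_left (sq_nonneg _)

theorem norm_shiftL {x : L2} (hx : x 0 = 0) : ‖shiftL x‖ = ‖x‖ :=
  (sq_eq_sq₀ (norm_nonneg _) (norm_nonneg _)).mp <| by
    rw [norm_shiftL_sq x, hx]
    simp

theorem norm_cell_le (x : L2) (i : ℕ) : ‖cell k x i‖ ≤ ‖x‖ :=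
  L2.norm_le_norm <| tsum_comp_le_tsum_of_inj (L2.summable_sq x) (fun n => sq_nonneg _)
    (i := fun n => k * n + i) fun m n h => by simpa [NeZero.ne k] using h

/-- The squared norms of the residue classes add up to that of `x`, and an ℓ² norm is at most the ℓ¹
norm. -/
theorem norm_le_sum_cell (x : L2) : ‖x‖ ≤ ∑ i ∈ Finset.range k, ‖cell k x i‖ := by
  have h : ‖x‖ ^ 2 = ∑ i ∈ Finset.range k, ‖cell k x i‖ ^ 2 := by
    have hs : Summable fun q : ℕ × Fin k => ‖x ((Nat.divModEquiv k).symm q)‖ ^ 2 :=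
      (L2.summable_sq x).comp_injective (Nat.divModEquiv k).symm.injective
    rw [L2.norm_sq, ← (Nat.divModEquiv k).symm.tsum_eq,
      hs.tsum_prod' fun n => (hasSum_fintype _).summable]
    simp only [tsum_fintype]
    rw [Summable.tsum_finsetSum, Finset.sum_range]
    · refine Finset.sum_congr rfl fun i _ => ?_
      rw [L2.norm_sq]
      refine tsum_congr fun n => ?_
      simp [Nat.divModEquiv, mul_comm]
    · intro i _
      exact hs.comp_injective (i := fun n => (n, i)) fun m n h => by simpa using h
  refine (sq_le_sq₀ (norm_nonneg _) (Finset.sum_nonneg fun i _ => norm_nonneg _)).mp ?_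
  rw [h]
  exact Finset.sum_sq_le_sq_sum_of_nonneg fun i _ => norm_nonneg _

end Sequences

/-! ### The three-term recurrence within a unit cell. -/

variable {k : ℕ} [NeZero k]

/-- The periodic diagonal of the operator. -/
def diag (S : RealSymbol k) (n : ℕ) : ℝ := S.a (Fin.ofNat k n)

/-- The periodic off-diagonal of the operator. -/
def off (S : RealSymbol k) (n : ℕ) : ℝ := S.b (Fin.ofNat k n)

theorem diag_mul_add (S : RealSymbol k) (n i : ℕ) : S.diag (k * n + i) = S.diag i := by
  simp [diag, Fin.ofNat]

theorem off_mul_add (S : RealSymbol k) (n i : ℕ) : S.off (k * n + i) = S.off i := by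
  simp [off, Fin.ofNat]

theorem Nondegenerate.off_ne_zero {S : RealSymbol k} (hS : S.Nondegenerate) {n : ℕ}
    (hn : n + 1 < k) : S.off n ≠ 0 :=
  hS _ (by simpa [Fin.ofNat, Nat.mod_eq_of_lt (show n < k by omega)] using hn)

theorem toeplitzFun_eq (S : RealSymbol k) (x : ℕ → ℂ) (n : ℕ) :
    S.toeplitzFun x n = S.diag n * x n + S.off n * x (n + 1) +
      if n = 0 then 0 else S.off (n - 1) * x (n - 1) := rfl

/-- The solution of the three-term recurrence of `T(f) - β` within the first unit cell, normalised
to `1` at the left end. -/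
def sol (S : RealSymbol k) (β : ℝ) : ℕ → ℝ
  | 0 => 1
  | 1 => (β - S.diag 0) / S.off 0
  | n + 2 => ((β - S.diag (n + 1)) * S.sol β (n + 1) - S.off n * S.sol β n) / S.off (n + 1)

@[simp] theorem sol_zero (S : RealSymbol k) (β : ℝ) : S.sol β 0 = 1 := by rw [sol]

theorem off_mul_sol_one {S : RealSymbol k} (hS : S.Nondegenerate) (β : ℝ) (hk : 1 < k) :
    S.off 0 * S.sol β 1 = β - S.diag 0 := by
  rw [sol, mul_div_cancel₀ _ (hS.off_ne_zero hk)]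

/-- The bound on `n` keeps the divisor of `sol` among the couplings inside the cell; the next one is
`b_k`, which may vanish. -/
theorem off_mul_sol {S : RealSymbol k} (hS : S.Nondegenerate) (β : ℝ) {n : ℕ} (hn : n + 2 < k) :
    S.off (n + 1) * S.sol β (n + 2) =
      (β - S.diag (n + 1)) * S.sol β (n + 1) - S.off n * S.sol β n := by
  rw [sol, mul_div_cancel₀ _ (hS.off_ne_zero hn)]

/-- Two consecutive zeros would propagate back to the initial value 1. -/
theorem sol_ne_zero_of_succ {S : RealSymbol k} (hS : S.Nondegenerate) (β : ℝ) {n : ℕ}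
    (hn : n + 1 < k) (h : S.sol β (n + 1) = 0) : S.sol β n ≠ 0 := by
  induction n with
  | zero => simp
  | succ n ih =>
    intro h0
    refine ih (by omega) h0 ?_
    have := off_mul_sol hS β (n := n) hn
    rw [h, h0, mul_zero, mul_zero, zero_sub, zero_eq_neg] at this
    exact (mul_eq_zero.mp this).resolve_left (hS.off_ne_zero (by omega))

/-- The coupling of the last site of the unit cell to the solution within the cell. -/
def innerCoupling (S : RealSymbol k) (β : ℝ) : ℝ := S.off (k - 2) * S.sol β (k - 2)

/-- The coupling between neighbouring unit cells. -/
def outerCoupling (S : RealSymbol k) : ℝ := S.off (k - 1)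

theorem innerCoupling_ne_zero {S : RealSymbol k} (hS : S.Nondegenerate) {β : ℝ} (hk : 1 < k)
    (hβ : S.sol β (k - 1) = 0) : S.innerCoupling β ≠ 0 :=
  mul_ne_zero (hS.off_ne_zero (by omega)) <| sol_ne_zero_of_succ hS β (by omega) <| by
    rwa [show k - 2 + 1 = k - 1 by omega]

/-- The operator `T(f) - β`. -/
abbrev shifted (S : RealSymbol k) (β : ℝ) : L2 →L[ℂ] L2 :=
  S.toeplitz - (β : ℂ) • ContinuousLinearMap.id ℂ L2

/-! ### Lower bounds for `T(f) - β`, one residue class at a time. -/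

theorem shifted_apply (S : RealSymbol k) (β : ℝ) (x : L2) (n : ℕ) :
    S.shifted β x n = S.toeplitzFun x n - β * x n := by
  rfl

/-- The left neighbour of a first site is the last site of the previous cell; the zero inserted by
`shiftR` is the boundary condition at the edge. -/
theorem cell_shifted_zero (S : RealSymbol k) (β : ℝ) (hk : 1 < k) (x : L2) :
    cell k (S.shifted β x) 0 = ((S.diag 0 - β : ℝ) : ℂ) • cell k x 0 +
      (S.off 0 : ℂ) • cell k x 1 + (S.outerCoupling : ℂ) • shiftR (cell k x (k - 1)) := by
  ext n
  simp only [cell_apply, shifted_apply, toeplitzFun_eq, lp.coeFn_add, Pi.add_apply, lp.coeFn_smul,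
    Pi.smul_apply, smul_eq_mul, shiftR_apply, diag_mul_add, off_mul_add, outerCoupling]
  rcases n with _ | n
  · simp
    ring
  · have h : k * (n + 1) + 0 - 1 = k * n + (k - 1) := by rw [mul_add]; omega
    rw [h, off_mul_add]
    simp [show k ≠ 0 by omega]
    ring

/-- Used up to `i = k - 2`, where `cell k x (i + 2)` already belongs to the next cell. -/
theorem cell_shifted_succ (S : RealSymbol k) (β : ℝ) (x : L2) (i : ℕ) :
    cell k (S.shifted β x) (i + 1) = (S.off i : ℂ) • cell k x i +
      ((S.diag (i + 1) - β : ℝ) : ℂ) • cell k x (i + 1) + (S.off (i + 1) : ℂ) • cell k x (i + 2) := by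
  ext n
  have h : k * n + (i + 1) - 1 = k * n + i := by omega
  simp only [cell_apply, shifted_apply, toeplitzFun_eq, lp.coeFn_add, Pi.add_apply, lp.coeFn_smul,
    Pi.smul_apply, smul_eq_mul, diag_mul_add, off_mul_add, h]
  simp
  ring_nf

/-- The discrete Wronskian identity within a unit cell. -/
theorem sum_sol_smul_cell {S : RealSymbol k} (hS : S.Nondegenerate) (β : ℝ) (x : L2) {m : ℕ}
    (hm : m + 1 < k) :
    ∑ i ∈ Finset.range (m + 1), (S.sol β i : ℂ) • cell k (S.shifted β x) i =
      (S.outerCoupling : ℂ) • shiftR (cell k x (k - 1)) +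
        (S.off m : ℂ) • ((S.sol β m : ℂ) • cell k x (m + 1) - (S.sol β (m + 1) : ℂ) • cell k x m) := by
  induction m with
  | zero =>
    have h := congrArg (Complex.ofReal) (off_mul_sol_one hS β hm)
    push_cast at h
    rw [Finset.sum_range_one, cell_shifted_zero S β hm, sol_zero, smul_sub, smul_smul, smul_smul, h]
    push_cast
    module
  | succ m ih =>
    have h := congrArg (Complex.ofReal) (off_mul_sol hS β (n := m) hm)
    push_cast at h
    rw [Finset.sum_range_succ, ih (by omega), cell_shifted_succ S β, smul_sub _ _ (_ • cell k x (m + 1)),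
      smul_smul (S.off (m + 1) : ℂ) (S.sol β (m + 2) : ℂ), h]
    push_cast
    module

theorem norm_ofReal_smul (c : ℝ) (x : L2) : ‖(c : ℂ) • x‖ = |c| * ‖x‖ := by
  rw [norm_smul, Complex.norm_real, Real.norm_eq_abs]

theorem abs_sub_mul_norm_le_of_norm_eq (α γ : ℝ) {x y : L2} (h : ‖y‖ = ‖x‖) :
    abs (|α| - |γ|) * ‖x‖ ≤ ‖(α : ℂ) • x + (γ : ℂ) • y‖ := by
  have h1 := norm_sub_le_norm_add ((α : ℂ) • x) ((γ : ℂ) • y)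
  have h2 := norm_sub_le_norm_add ((γ : ℂ) • y) ((α : ℂ) • x)
  rw [add_comm ((γ : ℂ) • y)] at h2
  rw [norm_ofReal_smul, norm_ofReal_smul, h] at h1 h2
  rcases abs_cases (|α| - |γ|) with ⟨h3, _⟩ | ⟨h3, _⟩ <;> rw [h3] <;> linarith

/-- At `m = k - 2` the Wronskian identity loses its last term because `sol` vanishes at `k - 1`.
What remains is α + γ·(right shift) acting on the last residue class; the shift is isometric, so |α|
≠ |γ| bounds this from below without any boundary condition. -/
theorem exists_bound_last_cell {S : RealSymbol k} (hS : S.Nondegenerate) {β : ℝ} (hk : 1 < k)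
    (hβ : S.sol β (k - 1) = 0) (hne : |S.innerCoupling β| ≠ |S.outerCoupling|) :
    ∃ M : ℝ, 0 ≤ M ∧ ∀ x : L2, ‖cell k x (k - 1)‖ ≤ M * ‖S.shifted β x‖ := by
  have hd : 0 < abs (|S.innerCoupling β| - |S.outerCoupling|) := abs_pos.mpr (sub_ne_zero.mpr hne)
  refine ⟨(∑ i ∈ Finset.range (k - 1), |S.sol β i|) / abs (|S.innerCoupling β| - |S.outerCoupling|),
    by positivity, fun x => ?_⟩
  have h := sum_sol_smul_cell hS β x (m := k - 2) (by omega)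
  rw [show k - 2 + 1 = k - 1 by omega, hβ, Complex.ofReal_zero, zero_smul, sub_zero, smul_smul,
    ← Complex.ofReal_mul, ← innerCoupling] at h
  have h1 := abs_sub_mul_norm_le_of_norm_eq (S.innerCoupling β) S.outerCoupling
    (norm_shiftR (cell k x (k - 1)))
  rw [add_comm, ← h] at h1
  rw [div_mul_eq_mul_div, le_div_iff₀ hd, mul_comm]
  refine h1.trans ((norm_sum_le _ _).trans ?_)
  rw [Finset.sum_mul]
  refine Finset.sum_le_sum fun i _ => ?_
  rw [norm_ofReal_smul]
  exact mul_le_mul_of_nonneg_left (norm_cell_le _ _) (abs_nonneg _)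

/-- The deviation from the exact solution obeys the same recurrence with sources `T(f)x - βx` and,
at the first site, the last residue class, which is already controlled. -/
theorem exists_bound_cell_sub {S : RealSymbol k} (hS : S.Nondegenerate) {β : ℝ} (hk : 1 < k)
    (hβ : S.sol β (k - 1) = 0) (hne : |S.innerCoupling β| ≠ |S.outerCoupling|) (i : ℕ)
    (hi : i < k) :
    ∃ M : ℝ, 0 ≤ M ∧ ∀ x : L2,
      ‖cell k x i - (S.sol β i : ℂ) • cell k x 0‖ ≤ M * ‖S.shifted β x‖ := by
  obtain ⟨L, hL0, hL⟩ := exists_bound_last_cell hS hk hβ hne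
  have aux : ∀ (c : ℝ), c ≠ 0 → ∀ (u : L2 → L2) (M : ℝ), 0 ≤ M →
      (∀ x, ‖(c : ℂ) • u x‖ ≤ M * ‖S.shifted β x‖) →
      ∃ M : ℝ, 0 ≤ M ∧ ∀ x, ‖u x‖ ≤ M * ‖S.shifted β x‖ := fun c hc u M hM h => by
    refine ⟨M / |c|, by positivity, fun x => ?_⟩
    have := h x
    rw [norm_ofReal_smul] at this
    rw [div_mul_eq_mul_div, le_div_iff₀ (abs_pos.mpr hc), mul_comm]
    exact this
  induction i using Nat.strong_induction_on with
  | _ i ih =>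
    match i, ih, hi with
    | 0, _, _ => exact ⟨0, le_rfl, fun x => by simp⟩
    | 1, _, _ =>
      refine aux (S.off 0) (hS.off_ne_zero hk) _ (1 + |S.outerCoupling| * L) (by positivity)
        fun x => ?_
      have e : (S.off 0 : ℂ) • (cell k x 1 - (S.sol β 1 : ℂ) • cell k x 0) =
          cell k (S.shifted β x) 0 - (S.outerCoupling : ℂ) • shiftR (cell k x (k - 1)) := by
        have h := congrArg (Complex.ofReal) (off_mul_sol_one hS β hk)
        push_cast at h
        rw [cell_shifted_zero S β hk, smul_sub, smul_smul, h]
        push_cast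
        module
      rw [e]
      refine (norm_sub_le _ _).trans ?_
      rw [norm_ofReal_smul, norm_shiftR, add_mul, one_mul, mul_assoc]
      exact add_le_add (norm_cell_le _ _) (mul_le_mul_of_nonneg_left (hL x) (abs_nonneg _))
    | i + 2, ih, hi =>
      obtain ⟨M0, hM0, h0⟩ := ih i (by omega) (by omega)
      obtain ⟨M1, hM1, h1⟩ := ih (i + 1) (by omega) (by omega)
      refine aux (S.off (i + 1)) (hS.off_ne_zero hi) _
        (1 + |S.off i| * M0 + |S.diag (i + 1) - β| * M1) (by positivity) fun x => ?_
      have e : (S.off (i + 1) : ℂ) • (cell k x (i + 2) - (S.sol β (i + 2) : ℂ) • cell k x 0) =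
          cell k (S.shifted β x) (i + 1) -
            (S.off i : ℂ) • (cell k x i - (S.sol β i : ℂ) • cell k x 0) -
            ((S.diag (i + 1) - β : ℝ) : ℂ) •
              (cell k x (i + 1) - (S.sol β (i + 1) : ℂ) • cell k x 0) := by
        have h := congrArg (Complex.ofReal) (off_mul_sol hS β (n := i) hi)
        push_cast at h
        rw [cell_shifted_succ S β, smul_sub (S.off (i + 1) : ℂ), smul_smul (S.off (i + 1) : ℂ), h]
        push_cast
        module
      rw [e]
      refine (norm_sub_le _ _).trans ?_
      refine (add_le_add_left (norm_sub_le _ _) _).trans ?_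
      rw [norm_ofReal_smul, norm_ofReal_smul, add_mul, add_mul, one_mul, mul_assoc, mul_assoc]
      exact add_le_add (add_le_add (norm_cell_le _ _)
        (mul_le_mul_of_nonneg_left (h0 x) (abs_nonneg _)))
        (mul_le_mul_of_nonneg_left (h1 x) (abs_nonneg _))

/-- The row of the last site reads α·x₀ + γ·(left shift of x₀), up to controlled terms, with x₀ the
first residue class. The left shift is only a contraction, enough when |γ| < |α|; it becomes
isometric on sequences vanishing at the edge, which explains the alternative in the hypothesis. -/
theorem exists_bound_first_cell {S : RealSymbol k} (hS : S.Nondegenerate) {β : ℝ} (hk : 1 < k)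
    (hβ : S.sol β (k - 1) = 0) (hne : |S.innerCoupling β| ≠ |S.outerCoupling|) :
    ∃ M : ℝ, 0 ≤ M ∧ ∀ x : L2, |S.outerCoupling| < |S.innerCoupling β| ∨ x 0 = 0 →
      ‖cell k x 0‖ ≤ M * ‖S.shifted β x‖ := by
  obtain ⟨L, hL0, hL⟩ := exists_bound_last_cell hS hk hβ hne
  obtain ⟨M, hM0, hM⟩ := exists_bound_cell_sub hS hk hβ hne (k - 2) (by omega)
  have hd : 0 < abs (|S.innerCoupling β| - |S.outerCoupling|) := abs_pos.mpr (sub_ne_zero.mpr hne)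
  refine ⟨(1 + |S.diag (k - 1) - β| * L + |S.off (k - 2)| * M) /
    abs (|S.innerCoupling β| - |S.outerCoupling|), by positivity, fun x hx => ?_⟩
  have e : (S.innerCoupling β : ℂ) • cell k x 0 + (S.outerCoupling : ℂ) • shiftL (cell k x 0) =
      cell k (S.shifted β x) (k - 1) - ((S.diag (k - 1) - β : ℝ) : ℂ) • cell k x (k - 1) -
        (S.off (k - 2) : ℂ) • (cell k x (k - 2) - (S.sol β (k - 2) : ℂ) • cell k x 0) := by
    have h := cell_shifted_succ S β x (k - 2)
    rw [show k - 2 + 1 = k - 1 by omega, show k - 2 + 2 = k by omega, cell_add_period] at h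
    rw [h, innerCoupling, outerCoupling]
    push_cast
    module
  have h1 : abs (|S.innerCoupling β| - |S.outerCoupling|) * ‖cell k x 0‖ ≤
      ‖(S.innerCoupling β : ℂ) • cell k x 0 + (S.outerCoupling : ℂ) • shiftL (cell k x 0)‖ := by
    rcases hx with hx | hx
    · rw [abs_of_pos (sub_pos.mpr hx)]
      have h2 := norm_sub_le_norm_add ((S.innerCoupling β : ℂ) • cell k x 0)
        ((S.outerCoupling : ℂ) • shiftL (cell k x 0))
      rw [norm_ofReal_smul, norm_ofReal_smul] at h2
      have := mul_le_mul_of_nonneg_left (norm_shiftL_le (cell k x 0)) (abs_nonneg S.outerCoupling)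
      linarith
    · exact abs_sub_mul_norm_le_of_norm_eq _ _ (norm_shiftL (by simpa using hx))
  rw [div_mul_eq_mul_div, le_div_iff₀ hd, mul_comm]
  refine h1.trans ?_
  rw [e]
  refine (norm_sub_le _ _).trans ?_
  refine (add_le_add_left (norm_sub_le _ _) _).trans ?_
  rw [norm_ofReal_smul, norm_ofReal_smul, add_mul, add_mul, one_mul, mul_assoc, mul_assoc]
  exact add_le_add (add_le_add (norm_cell_le _ _)
    (mul_le_mul_of_nonneg_left (hL x) (abs_nonneg _)))
    (mul_le_mul_of_nonneg_left (hM x) (abs_nonneg _))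

/-- `T(f) - β` is bounded below: on all of `ℓ²` if the inner coupling dominates, and on the
sequences vanishing at `0` otherwise. -/
theorem exists_norm_le_shifted {S : RealSymbol k} (hS : S.Nondegenerate) {β : ℝ} (hk : 1 < k)
    (hβ : S.sol β (k - 1) = 0) (hne : |S.innerCoupling β| ≠ |S.outerCoupling|) :
    ∃ M : ℝ, 0 ≤ M ∧ ∀ x : L2, |S.outerCoupling| < |S.innerCoupling β| ∨ x 0 = 0 →
      ‖x‖ ≤ M * ‖S.shifted β x‖ := by
  obtain ⟨L, hL0, hL⟩ := exists_bound_first_cell hS hk hβ hne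
  have hc : ∀ i ∈ Finset.range k, ∃ M : ℝ, 0 ≤ M ∧ ∀ x : L2,
      |S.outerCoupling| < |S.innerCoupling β| ∨ x 0 = 0 →
        ‖cell k x i‖ ≤ M * ‖S.shifted β x‖ := fun i hi => by
    obtain ⟨M, hM0, hM⟩ := exists_bound_cell_sub hS hk hβ hne i (Finset.mem_range.mp hi)
    refine ⟨M + |S.sol β i| * L, by positivity, fun x hx => ?_⟩
    have h : cell k x i =
        (cell k x i - (S.sol β i : ℂ) • cell k x 0) + (S.sol β i : ℂ) • cell k x 0 := by module
    rw [h]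
    refine (norm_add_le _ _).trans ?_
    rw [norm_ofReal_smul, add_mul, mul_assoc]
    exact add_le_add (hM x) (mul_le_mul_of_nonneg_left (hL x hx) (abs_nonneg _))
  choose! M hM0 hM using hc
  refine ⟨∑ i ∈ Finset.range k, M i, Finset.sum_nonneg hM0, fun x hx => ?_⟩
  rw [Finset.sum_mul]
  exact (norm_le_sum_cell (k := k) x).trans (Finset.sum_le_sum fun i hi => hM i hi x hx)

end RealSymbol

end TriToeplitz

/-! ### A Fredholm criterion for symmetric operators. -/

section Fredholm

open Module InnerProductSpace Topology

/-- A symmetric operator on a Hilbert space that is bounded below on a closed subspace of finite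
codimension is Fredholm. -/
theorem ContinuousLinearMap.isFredholm_of_isSymmetric_of_norm_le {H : Type*}
    [NormedAddCommGroup H] [InnerProductSpace ℂ H] [CompleteSpace H] {u : H →L[ℂ] H}
    (hu : (u : H →ₗ[ℂ] H).IsSymmetric) (V : Submodule ℂ H) (hV : IsClosed (V : Set H)) [V.CoFG]
    {M : ℝ} (hM : 0 ≤ M) (h : ∀ x ∈ V, ‖x‖ ≤ M * ‖u x‖) : u.IsFredholm := by
  have hanti : AntilipschitzWith ⟨M, hM⟩ (u.domRestrict V) :=
    ContinuousLinearMap.antilipschitz_of_bound _ fun x => h x x.2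
  have : CompleteSpace V := hV.completeSpace_coe
  obtain ⟨hstrict, hclosed⟩ := (u.isStrictMap_isClosed_range_iff_restrict V hV).mpr
    ⟨(hanti.isUniformEmbedding (u.domRestrict V).uniformContinuous).isEmbedding.isStrictMap,
      hanti.isClosed_range (u.domRestrict V).uniformContinuous⟩
  have hdisj : Disjoint u.ker V := by
    rw [Submodule.disjoint_def]
    intro x hx hxV
    have hx0 : u x = 0 := hx
    simpa [hx0] using h x hxV
  have hker : FiniteDimensional ℂ u.ker :=
    .of_fg (Submodule.CoFG.fg_of_disjoint hdisj inferInstance)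
  -- For a self-adjoint operator with closed range the cokernel is a copy of the kernel, so only the
  -- kernel has to be finite-dimensional.
  have hperp : u.rangeᗮ = u.ker := by
    rw [u.orthogonal_range, (ContinuousLinearMap.isSelfAdjoint_iff_isSymmetric.mpr hu).adjoint_eq]
  have : CompleteSpace u.range := hclosed.completeSpace_coe
  have hcompl : IsCompl u.range u.ker := hperp ▸ Submodule.isCompl_orthogonal _
  exact ⟨hstrict, hclosed, hker,
    Module.Finite.equiv (Submodule.quotientEquivOfIsCompl _ _ hcompl).symm,
    .of_finiteDimensional _⟩

theorem ContinuousLinearMap.coFG_ker_of_finiteDimensional {E F : Type*} [AddCommGroup E]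
    [Module ℂ E] [TopologicalSpace E] [AddCommGroup F] [Module ℂ F] [TopologicalSpace F]
    [FiniteDimensional ℂ F] (f : E →L[ℂ] F) : f.ker.CoFG :=
  Module.Finite.equiv (LinearMap.quotKerEquivRange f.toLinearMap).symm

end Fredholm

/-! ### Fredholmness, Bloch solutions and edge states of `T(f)`. -/

namespace TriToeplitz

namespace RealSymbol

open InnerProductSpace

variable {k : ℕ} [NeZero k]

/-- Multiplication by a real periodic sequence on `ℓ²(ℕ)`. -/
def periodicMul (c : Fin k → ℝ) (x : L2) : L2 :=
  ⟨fun n => (c (Fin.ofNat k n) : ℂ) * x n, memlp_periodic_mul c (lp.memℓp x)⟩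

theorem inner_periodicMul (c : Fin k → ℝ) (x y : L2) :
    ⟪periodicMul c x, y⟫_ℂ = ⟪x, periodicMul c y⟫_ℂ := by
  rw [lp.inner_eq_tsum, lp.inner_eq_tsum]
  refine tsum_congr fun n => ?_
  simp [periodicMul]
  ring

theorem inner_shiftR (x y : L2) : ⟪shiftR x, y⟫_ℂ = ⟪x, shiftL y⟫_ℂ := by
  have h : Summable fun n => ⟪shiftR x n, y n⟫_ℂ := lp.summable_inner (shiftR x) y
  rw [lp.inner_eq_tsum, lp.inner_eq_tsum, h.tsum_eq_zero_add]
  simp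

theorem inner_shiftL (x y : L2) : ⟪shiftL x, y⟫_ℂ = ⟪x, shiftR y⟫_ℂ := by
  rw [← inner_conj_symm, ← inner_shiftR, inner_conj_symm]

theorem toeplitz_eq (S : RealSymbol k) (x : L2) :
    S.toeplitz x = periodicMul S.a x + periodicMul S.b (shiftL x) + shiftR (periodicMul S.b x) := by
  ext n
  rfl

theorem isSymmetric_toeplitz (S : RealSymbol k) : (S.toeplitz : L2 →ₗ[ℂ] L2).IsSymmetric := by
  intro x y
  simp only [ContinuousLinearMap.coe_coe, toeplitz_eq, inner_add_left, inner_add_right,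
    inner_periodicMul, inner_shiftR, inner_shiftL]
  ring

theorem isSymmetric_shifted (S : RealSymbol k) (β : ℝ) :
    (S.shifted β : L2 →ₗ[ℂ] L2).IsSymmetric := by
  intro x y
  have h := S.isSymmetric_toeplitz x y
  simp only [ContinuousLinearMap.coe_coe] at h ⊢
  have e : ∀ z, S.shifted β z = S.toeplitz z - (β : ℂ) • z := fun z => rfl
  rw [e, e, inner_sub_left, inner_sub_right, h, inner_smul_left, inner_smul_right,
    Complex.conj_ofReal]

/-- The hyperplane of sequences vanishing at 0 has a lower bound in both regimes, so no case
distinction is needed. -/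
theorem isFredholm_shifted {S : RealSymbol k} (hS : S.Nondegenerate) {β : ℝ} (hk : 1 < k)
    (hβ : S.sol β (k - 1) = 0) (hne : |S.innerCoupling β| ≠ |S.outerCoupling|) :
    (S.shifted β).IsFredholm := by
  obtain ⟨M, hM0, hM⟩ := exists_norm_le_shifted hS hk hβ hne
  let e := lp.evalCLM ℂ (fun _ : ℕ => ℂ) 2 0
  have : e.ker.CoFG := e.coFG_ker_of_finiteDimensional
  exact ContinuousLinearMap.isFredholm_of_isSymmetric_of_norm_le (S.isSymmetric_shifted β)
    e.ker e.isClosed_ker hM0 fun x hx => hM x (Or.inr hx)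

/-- The Bloch solution with multiplier `q`, built from the solution in a single cell. -/
def bloch (S : RealSymbol k) (β q : ℝ) (n : ℕ) : ℝ := q ^ (n / k) * S.sol β (n % k)

theorem bloch_mul_add (S : RealSymbol k) (β q : ℝ) (n : ℕ) {i : ℕ} (hi : i < k) :
    S.bloch β q (k * n + i) = q ^ n * S.sol β i := by
  rw [bloch, Nat.mul_add_div (by omega), Nat.div_eq_of_lt hi, Nat.mul_add_mod,
    Nat.mod_eq_of_lt hi, add_zero]

theorem bloch_mul (S : RealSymbol k) (β q : ℝ) (n : ℕ) : S.bloch β q (k * n) = q ^ n := by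
  simpa using S.bloch_mul_add β q n (Nat.pos_of_ne_zero (NeZero.ne k))

theorem exists_eq_mul_add (k : ℕ) [NeZero k] (n : ℕ) : ∃ m i, i < k ∧ n = k * m + i :=
  ⟨n / k, n % k, Nat.mod_lt _ (Nat.pos_of_ne_zero (NeZero.ne k)), (Nat.div_add_mod n k).symm⟩

/-- Inside a cell this is the recurrence of `sol`. First sites feel nothing from the left since
`sol` vanishes at `k - 1`, which also settles the boundary row. Only last sites constrain `q`,
through γq = -α. -/
theorem bloch_rec {S : RealSymbol k} (hS : S.Nondegenerate) {β q : ℝ} (hk : 1 < k)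
    (hβ : S.sol β (k - 1) = 0) (hq : S.outerCoupling * q = -S.innerCoupling β) (n : ℕ) :
    S.diag n * S.bloch β q n + S.off n * S.bloch β q (n + 1) +
      (if n = 0 then 0 else S.off (n - 1) * S.bloch β q (n - 1)) = β * S.bloch β q n := by
  obtain ⟨m, i, hi, rfl⟩ := exists_eq_mul_add k n
  rw [diag_mul_add, off_mul_add, bloch_mul_add _ _ _ _ hi]
  rcases i with _ | i
  · have h0 : (if k * m + 0 = 0 then 0 else
        S.off (k * m + 0 - 1) * S.bloch β q (k * m + 0 - 1)) = 0 := by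
      rcases m with _ | m
      · simp
      · rw [show k * (m + 1) + 0 - 1 = k * m + (k - 1) by rw [mul_add]; omega,
          bloch_mul_add _ _ _ _ (by omega), hβ]
        simp
    rw [h0]
    simp only [add_zero]
    rw [bloch_mul_add _ _ _ _ hk, sol_zero]
    linear_combination q ^ m * off_mul_sol_one hS β hk
  · rw [if_neg (by omega), show k * m + (i + 1) - 1 = k * m + i by omega, off_mul_add,
      bloch_mul_add _ _ _ _ (show i < k by omega)]
    rcases (show i + 2 < k ∨ i + 2 = k by omega) with h | h
    · rw [add_assoc (k * m), bloch_mul_add _ _ _ _ h]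
      linear_combination q ^ m * off_mul_sol hS β h
    · have h1 : i + 1 = k - 1 := by omega
      have h2 : i = k - 2 := by omega
      rw [add_assoc (k * m), show k * m + (i + 1 + 1) = k * (m + 1) by rw [mul_add]; omega,
        bloch_mul, h1, hβ, h2, pow_succ]
      rw [outerCoupling, innerCoupling] at hq
      linear_combination q ^ m * hq

theorem toeplitzFun_bloch {S : RealSymbol k} (hS : S.Nondegenerate) {β q : ℝ} (hk : 1 < k)
    (hβ : S.sol β (k - 1) = 0) (hq : S.outerCoupling * q = -S.innerCoupling β) (n : ℕ) :
    S.toeplitzFun (fun n => (S.bloch β q n : ℂ)) n = β * S.bloch β q n := by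
  rw [toeplitzFun_eq]
  have h := congrArg (Complex.ofReal) (bloch_rec hS hk hβ hq n)
  push_cast [apply_ite Complex.ofReal] at h
  exact h

/-- If the outer coupling dominates, then the Bloch solution is an edge state. -/
theorem isEdgeEigenvalue_of_lt {S : RealSymbol k} (hS : S.Nondegenerate) {β : ℝ} (hk : 1 < k)
    (hβ : S.sol β (k - 1) = 0) (h : |S.innerCoupling β| < |S.outerCoupling|) :
    S.IsEdgeEigenvalue β := by
  refine ⟨fun hn => hn (isFredholm_shifted hS hk hβ h.ne), ?_⟩
  have hγ : 0 < |S.outerCoupling| := (abs_nonneg _).trans_lt h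
  have hγ' : S.outerCoupling ≠ 0 := abs_pos.mp hγ
  have hα := innerCoupling_ne_zero hS hk hβ
  set q : ℝ := -S.innerCoupling β / S.outerCoupling with hqdef
  have hq : S.outerCoupling * q = -S.innerCoupling β := mul_div_cancel₀ _ hγ'
  have hq0 : 0 < |q| := abs_pos.mpr (div_ne_zero (neg_ne_zero.mpr hα) hγ')
  have hq1 : |q| < 1 := by rw [hqdef, abs_div, abs_neg, div_lt_one hγ]; exact h
  have hkpos : (0 : ℝ) < k := by exact_mod_cast (show 0 < k by omega)
  -- The decay per cell is |q|, hence its `k`-th root per site; `r ^ k` in the denominator of `C`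
  -- pays for the at most `k - 1` sites of an incomplete cell.
  set r : ℝ := |q| ^ ((k : ℝ)⁻¹) with hr
  have hr0 : 0 < r := Real.rpow_pos_of_pos hq0 _
  have hr1 : r < 1 := Real.rpow_lt_one hq0.le hq1 (by positivity)
  have hrk : r ^ k = |q| := Real.rpow_inv_natCast_pow hq0.le (by omega)
  set C : ℝ := (∑ i ∈ Finset.range k, |S.sol β i|) / r ^ k with hC
  have hbound : ∀ n, ‖(S.bloch β q n : ℂ)‖ ≤ C * r ^ n := fun n => by
    obtain ⟨m, i, hi, rfl⟩ := exists_eq_mul_add k n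
    rw [bloch_mul_add _ _ _ _ hi, Complex.norm_real, Real.norm_eq_abs, abs_mul, abs_pow, ← hrk,
      ← pow_mul, pow_add, hC, div_mul_eq_mul_div, le_div_iff₀ (by positivity)]
    have h1 : |S.sol β i| ≤ ∑ i ∈ Finset.range k, |S.sol β i| :=
      Finset.single_le_sum (f := fun i => |S.sol β i|) (fun _ _ => abs_nonneg _)
        (Finset.mem_range.mpr hi)
    have h2 : r ^ k ≤ r ^ i := pow_le_pow_of_le_one hr0.le hr1.le hi.le
    calc r ^ (k * m) * |S.sol β i| * r ^ k = |S.sol β i| * (r ^ (k * m) * r ^ k) := by ring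
      _ ≤ (∑ i ∈ Finset.range k, |S.sol β i|) * (r ^ (k * m) * r ^ i) := by gcongr
  have hsum : Summable fun n => ‖(S.bloch β q n : ℂ)‖ ^ 2 := by
    refine Summable.of_nonneg_of_le (fun n => sq_nonneg _)
      (fun n => pow_le_pow_left₀ (norm_nonneg _) (hbound n) 2) ?_
    simp_rw [mul_pow, ← pow_mul, mul_comm _ 2, pow_mul]
    exact (summable_geometric_of_lt_one (sq_nonneg _) (by nlinarith)).mul_left _
  refine ⟨⟨fun n => (S.bloch β q n : ℂ), memlp_of_summable_sq hsum⟩, fun h0 => ?_, ?_, C, r, hr0,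
    hr1, hbound⟩
  · have h1 : (S.bloch β q 0 : ℂ) = 0 := congrArg (fun v : L2 => v 0) h0
    have h2 := S.bloch_mul β q 0
    rw [mul_zero, pow_zero] at h2
    rw [h2] at h1
    exact one_ne_zero (Complex.ofReal_eq_zero.mp h1)
  · ext n
    exact toeplitzFun_bloch hS hk hβ hq n

/-- If α dominates, `T(f) - β` is bounded below on all of ℓ² and hence injective. -/
theorem isEdgeEigenvalue_iff {S : RealSymbol k} (hS : S.Nondegenerate) {β : ℝ} (hk : 1 < k)
    (hβ : S.sol β (k - 1) = 0) (hne : |S.innerCoupling β| ≠ |S.outerCoupling|) :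
    S.IsEdgeEigenvalue β ↔ |S.innerCoupling β| < |S.outerCoupling| := by
  refine ⟨fun ⟨_, v, hv0, hv, _⟩ => ?_, isEdgeEigenvalue_of_lt hS hk hβ⟩
  by_contra hlt
  obtain ⟨M, -, hM⟩ := exists_norm_le_shifted hS hk hβ hne
  have h := hM v (Or.inl (lt_of_le_of_ne (not_lt.mp hlt) hne.symm))
  have h0 : S.shifted β v = 0 := by
    change S.toeplitz v - (β : ℂ) • v = 0
    rw [hv, sub_self]
  rw [h0, norm_zero, mul_zero] at h
  exact hv0 (norm_le_zero_iff.mp h)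

theorem off_ne_zero_of_outerCoupling {S : RealSymbol k} (hS : S.Nondegenerate)
    (h : S.outerCoupling ≠ 0) (n : ℕ) : S.off n ≠ 0 := by
  obtain ⟨m, i, hi, rfl⟩ := exists_eq_mul_add k n
  rw [off_mul_add]
  rcases (show i + 1 < k ∨ i = k - 1 by omega) with h1 | rfl
  · exact hS.off_ne_zero h1
  · exact h

/-- If both couplings are equally strong, then `T(f) - β` is not Fredholm. -/
theorem not_isFredholm_shifted {S : RealSymbol k} (hS : S.Nondegenerate) {β : ℝ} (hk : 1 < k)
    (hβ : S.sol β (k - 1) = 0) (heq : |S.innerCoupling β| = |S.outerCoupling|) :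
    ¬ (S.shifted β).IsFredholm := by
  intro hF
  have hα := innerCoupling_ne_zero hS hk hβ
  have hγ : S.outerCoupling ≠ 0 := abs_pos.mp (heq ▸ abs_pos.mpr hα)
  set q : ℝ := -S.innerCoupling β / S.outerCoupling with hqdef
  have hq : S.outerCoupling * q = -S.innerCoupling β := mul_div_cancel₀ _ hγ
  have hq1 : |q| = 1 := by rw [hqdef, abs_div, abs_neg, heq, div_self (abs_pos.mpr hγ).ne']
  have hrec := toeplitzFun_bloch hS hk hβ hq
  -- A kernel element is `x 0` times the Bloch solution, whose modulus is 1 at every first site: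
  -- square summability forces `x 0 = 0`.
  have hinj : Function.Injective (S.shifted β) := by
    refine (injective_iff_map_eq_zero _).mpr fun x hx => ?_
    have hx' : ∀ n, S.toeplitzFun x n = β * x n := fun n => by
      have h := shifted_apply S β x n
      rw [hx] at h
      exact (sub_eq_zero.mp h.symm)
    have hxb : ∀ n, x n = x 0 * S.bloch β q n := by
      intro n
      induction n using Nat.strong_induction_on with
      | _ n ih =>
        rcases n with _ | n
        · have h2 := S.bloch_mul β q 0
          rw [mul_zero, pow_zero] at h2
          rw [h2]
          simp
        · have h1 := hx' n
          have h2 := hrec n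
          rw [toeplitzFun_eq] at h1 h2
          refine mul_left_cancel₀
            (Complex.ofReal_ne_zero.mpr (off_ne_zero_of_outerCoupling hS hγ n)) ?_
          rw [ih n (by omega)] at h1
          rcases n with _ | n
          · simp only [if_true, add_zero] at h1 h2
            linear_combination h1 - x 0 * h2
          · rw [if_neg (by omega), ih (n + 1 - 1) (by omega)] at h1
            rw [if_neg (by omega)] at h2
            linear_combination h1 - x 0 * h2
    have hconst : ∀ n, ‖cell k x 0 n‖ ^ 2 = ‖x 0‖ ^ 2 := fun n => by
      rw [cell_apply, add_zero, hxb, bloch_mul, norm_mul, Complex.norm_real, Real.norm_eq_abs,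
        abs_pow, hq1, one_pow, mul_one]
    have h0 := (L2.summable_sq (cell k x 0)).tendsto_atTop_zero
    simp_rw [hconst] at h0
    have hx0 : x 0 = 0 := by simpa using tendsto_nhds_unique tendsto_const_nhds h0
    ext n
    rw [hxb, hx0, zero_mul]
    rfl
  obtain ⟨K, hK⟩ := (S.shifted β).antilipschitz_of_injective_of_isClosed_range hinj
    hF.isClosed_range
  obtain ⟨N, hN⟩ := exists_nat_gt ((K * |S.outerCoupling|) ^ 2)
  -- The Bloch wave cut off after `N + 1` cells. Its squared norm is at least `N + 1`, while its
  -- image is a single entry of modulus |γ| at the last retained site: the first discarded site sees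
  -- only a zero of `sol`. This contradicts the lower bound with constant `K` by the choice of `N`.
  let x : L2 := ⟨fun n => if n < k * (N + 1) then (S.bloch β q n : ℂ) else 0,
    memlp_of_summable_sq <| summable_of_ne_finset_zero (s := Finset.range (k * (N + 1)))
      fun n hn => by simp [Finset.mem_range.not.mp hn]⟩
  have hx : ∀ n, x n = if n < k * (N + 1) then (S.bloch β q n : ℂ) else 0 := fun n => rfl
  have hkN : k ≤ k * (N + 1) := Nat.le_mul_of_pos_right k (Nat.succ_pos N)
  have himg : S.shifted β x =
      lp.single 2 (k * (N + 1) - 1) (-(S.outerCoupling * q ^ (N + 1) : ℝ) : ℂ) := by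
    ext n
    have hn := hrec n
    rw [toeplitzFun_eq] at hn
    rw [shifted_apply, toeplitzFun_eq, lp.single_apply, hx, hx, hx]
    have htail : n ≤ k * (N + 1) → (if n = 0 then (0 : ℂ) else S.off (n - 1) *
        if n - 1 < k * (N + 1) then (S.bloch β q (n - 1) : ℂ) else 0) =
        if n = 0 then 0 else (S.off (n - 1) : ℂ) * (S.bloch β q (n - 1) : ℂ) := fun h => by
      split_ifs with h1 h2
      · rfl
      · rfl
      · omega
    rcases lt_trichotomy (n + 1) (k * (N + 1)) with h | h | h
    · rw [htail (by omega), if_pos (by omega), if_pos h, Pi.single_eq_of_ne (by omega), hn,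
        sub_self]
    · have hoff : S.off n = S.outerCoupling := by
        rw [outerCoupling, show n = k * N + (k - 1) by rw [mul_add] at h; omega, off_mul_add]
      rw [h, bloch_mul, hoff] at hn
      rw [htail (by omega), if_pos (by omega), if_neg (by omega),
        show k * (N + 1) - 1 = n by omega, Pi.single_eq_same, ← hn]
      push_cast
      ring
    · rw [if_neg (by omega), if_neg (by omega), Pi.single_eq_of_ne (by omega), if_neg (by omega)]
      rcases (show n = k * (N + 1) ∨ k * (N + 1) < n by omega) with h1 | h1
      · rw [if_pos (by omega), show n - 1 = k * N + (k - 1) by rw [mul_add] at h1; omega,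
          bloch_mul_add _ _ _ _ (by omega), hβ]
        simp
      · rw [if_neg (by omega)]
        simp
  have hnorm : ‖S.shifted β x‖ = |S.outerCoupling| := by
    rw [himg, lp.norm_single (by norm_num), norm_neg, Complex.norm_real, Real.norm_eq_abs, abs_mul,
      abs_pow, hq1, one_pow, mul_one]
  have hle : ‖x‖ ≤ K * |S.outerCoupling| := by
    have h := hK.le_mul_dist x 0
    rwa [map_zero, dist_zero_right, dist_zero_right, hnorm] at h
  have hge : (N + 1 : ℝ) ≤ ‖x‖ ^ 2 := by
    calc (N + 1 : ℝ) = ∑ n ∈ Finset.range (N + 1), ‖cell k x 0 n‖ ^ 2 := by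
          rw [Finset.sum_congr rfl (g := fun _ => (1 : ℝ)), Finset.sum_const, Finset.card_range]
          · simp
          · intro n hn
            rw [cell_apply, add_zero, hx, if_pos (Nat.mul_lt_mul_of_pos_left
              (Finset.mem_range.mp hn) (by omega)), bloch_mul, Complex.norm_real,
              Real.norm_eq_abs, abs_pow, hq1, one_pow, one_pow]
      _ ≤ ‖cell k x 0‖ ^ 2 := by
          rw [L2.norm_sq]
          exact (L2.summable_sq (cell k x 0)).sum_le_tsum _ fun n _ => sq_nonneg _
      _ ≤ ‖x‖ ^ 2 := pow_le_pow_left₀ (norm_nonneg _) (norm_cell_le x 0) 2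
  have := pow_le_pow_left₀ (norm_nonneg _) hle 2
  linarith

end RealSymbol

end TriToeplitz

namespace TriToeplitz

namespace RealSymbol

open InnerProductSpace Module

variable {k : ℕ} [NeZero k]

/-! ### The symbol and its compression `B₀` -/

/-- The last site of the unit cell. -/
def lastSite (k : ℕ) [NeZero k] : Fin k :=
  ⟨k - 1, Nat.sub_one_lt (NeZero.ne k)⟩

/-- The inclusion of the sites other than the last one. -/
abbrev innerSite (i : Fin (k - 1)) : Fin k := Fin.castLE (Nat.sub_le k 1) i

theorem sum_innerSite {M : Type*} [AddCommMonoid M] (g : Fin k → M) :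
    ∑ i, g i = ∑ i : Fin (k - 1), g (innerSite i) + g (lastSite k) := by
  obtain ⟨m, rfl⟩ : ∃ m, k = m + 1 := ⟨k - 1, (Nat.succ_pred_eq_of_ne_zero (NeZero.ne k)).symm⟩
  exact Fin.sum_univ_castSucc g

/-- Both corner entries depending on `z` lie in the last row or the last column. -/
theorem symbol_innerSite (S : RealSymbol k) (z : ℂ) (i j : Fin (k - 1)) :
    S.symbol z (innerSite i) (innerSite j) = S.B0 i j := by
  have hi : (i : ℕ) + 1 ≠ k := by have := i.2; omega
  have hj : (j : ℕ) + 1 ≠ k := by have := j.2; omega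
  simp [symbol, B0, Aneg, Apos, hi, hj]

theorem symbol_mulVec_innerSite (S : RealSymbol k) (z : ℂ) {x : Fin k → ℂ}
    (hx : x (lastSite k) = 0) (i : Fin (k - 1)) :
    (S.symbol z).mulVec x (innerSite i) = S.B0.mulVec (fun j => x (innerSite j)) i := by
  simp only [Matrix.mulVec, dotProduct]
  rw [sum_innerSite, hx, mul_zero, add_zero]
  simp only [symbol_innerSite]

theorem off_val (S : RealSymbol k) (i : Fin k) : S.off i = S.b i := by
  simp [off]

theorem diag_val (S : RealSymbol k) (i : Fin k) : S.diag i = S.a i := by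
  simp [diag]

/-- The action of the symbol on a vector written as a sequence. -/
theorem symbol_mulVec_apply (S : RealSymbol k) (z : ℂ) (x : ℕ → ℂ) (i : Fin k) :
    (S.symbol z).mulVec (fun j => x j) i =
      S.diag i * x i + (if (i : ℕ) + 1 < k then S.off i * x (i + 1) else 0) +
        (if (i : ℕ) = 0 then 0 else S.off (i - 1) * x (i - 1)) +
        (if (i : ℕ) + 1 = k then z⁻¹ * (S.outerCoupling * x 0) else 0) +
        (if (i : ℕ) = 0 then z * (S.outerCoupling * x (k - 1)) else 0) := by
  have hk : 0 < k := Nat.pos_of_ne_zero (NeZero.ne k)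
  have hi := i.2
  -- Contributions are added as separate deltas because they can fall on the same entry, for
  -- instance when `k ≤ 2`. The inner test `i = 0` cancels the truncated `i - 1`.
  have e : ∀ j : Fin k, S.symbol z i j * x j = (fun j : ℕ =>
      (if j = i then S.diag i * x i else 0) + (if j = i + 1 then S.off i * x (i + 1) else 0) +
      (if j = (i : ℕ) - 1 then if (i : ℕ) = 0 then 0 else S.off (i - 1) * x (i - 1) else 0) +
      (if j = 0 then if (i : ℕ) + 1 = k then z⁻¹ * (S.outerCoupling * x 0) else 0 else 0) +
      (if j = k - 1 then if (i : ℕ) = 0 then z * (S.outerCoupling * x (k - 1)) else 0 else 0))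
      j := fun j => by
    have hj := j.2
    simp only [symbol, A0, Aneg, Apos, Matrix.add_apply, Matrix.smul_apply, Matrix.of_apply,
      smul_eq_mul, add_mul, outerCoupling, ← off_val, ← diag_val, Fin.ext_iff]
    have h1 : (if (i : ℕ) = j then (S.diag i : ℂ) else if (i : ℕ) + 1 = j then (S.off i : ℂ)
        else if (j : ℕ) + 1 = i then (S.off j : ℂ) else 0) * x j =
        (if (j : ℕ) = i then S.diag i * x i else 0) +
        (if (j : ℕ) = i + 1 then S.off i * x (i + 1) else 0) +
        (if (j : ℕ) = (i : ℕ) - 1 then if (i : ℕ) = 0 then 0 else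
          S.off (i - 1) * x (i - 1) else 0) := by
      by_cases ha : (i : ℕ) = j
      · rw [if_pos ha, if_pos ha.symm, if_neg (by omega), ← ha]
        split_ifs <;> first | omega | simp
      · rw [if_neg ha, if_neg (Ne.symm ha)]
        by_cases hb : (i : ℕ) + 1 = j
        · rw [if_pos hb, if_pos hb.symm, if_neg (by omega), ← hb]
          simp
        · rw [if_neg hb, if_neg (Ne.symm hb)]
          by_cases hc : (j : ℕ) + 1 = i
          · rw [if_pos hc, if_pos (by omega), if_neg (by omega), ← hc]
            simp
          · rw [if_neg hc]
            split_ifs <;> first | omega | simp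
    have h2 : (z⁻¹ * if (i : ℕ) + 1 = k ∧ (j : ℕ) = 0 then (S.off i : ℂ) else 0) * x j =
        if (j : ℕ) = 0 then
          if (i : ℕ) + 1 = k then z⁻¹ * (S.off (k - 1) * x 0) else 0 else 0 := by
      by_cases ha : (i : ℕ) + 1 = k
      · by_cases hb : (j : ℕ) = 0
        · rw [if_pos ⟨ha, hb⟩, if_pos hb, if_pos ha, hb, show (i : ℕ) = k - 1 by omega, mul_assoc]
        · simp [hb]
      · simp [ha]
    have h3 : (z * if (i : ℕ) = 0 ∧ (j : ℕ) + 1 = k then (S.off j : ℂ) else 0) * x j =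
        if (j : ℕ) = k - 1 then
          if (i : ℕ) = 0 then z * (S.off (k - 1) * x (k - 1)) else 0 else 0 := by
      by_cases ha : (i : ℕ) = 0
      · by_cases hb : (j : ℕ) = k - 1
        · rw [if_pos ⟨ha, by omega⟩, if_pos hb, if_pos ha, hb, mul_assoc]
        · rw [if_neg (by omega), if_neg hb, mul_zero, zero_mul]
      · simp [ha]
    rw [h1, h2, h3]
    ring
  simp only [Matrix.mulVec, dotProduct, e]
  rw [Fin.sum_univ_eq_sum_range (fun j : ℕ =>
      (if j = i then S.diag i * x i else 0) + (if j = i + 1 then S.off i * x (i + 1) else 0) +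
      (if j = (i : ℕ) - 1 then if (i : ℕ) = 0 then 0 else S.off (i - 1) * x (i - 1) else 0) +
      (if j = 0 then if (i : ℕ) + 1 = k then z⁻¹ * (S.outerCoupling * x 0) else 0 else 0) +
      (if j = k - 1 then if (i : ℕ) = 0 then z * (S.outerCoupling * x (k - 1)) else 0 else 0)) k]
  simp only [Finset.sum_add_distrib, Finset.sum_ite_eq', Finset.mem_range]
  rw [if_pos hi, if_pos (show (i : ℕ) - 1 < k by omega), if_pos hk,
    if_pos (show k - 1 < k by omega)]

/-- The recurrence determines a solution within a cell from its first entry. -/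
theorem eq_mul_sol {S : RealSymbol k} (hS : S.Nondegenerate) {β : ℝ} {x : ℕ → ℂ}
    (hx : ∀ i, i + 1 < k → S.diag i * x i + S.off i * x (i + 1) +
      (if i = 0 then 0 else S.off (i - 1) * x (i - 1)) = β * x i) (n : ℕ) (hn : n < k) :
    x n = x 0 * S.sol β n := by
  induction n using Nat.strong_induction_on with
  | _ n ih =>
    match n, ih, hn with
    | 0, _, _ => simp
    | 1, _, hn =>
      refine mul_left_cancel₀ (Complex.ofReal_ne_zero.mpr (hS.off_ne_zero hn)) ?_
      have h := hx 0 hn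
      have h1 := congrArg (Complex.ofReal) (off_mul_sol_one hS β hn)
      push_cast at h1
      simp only [if_true, zero_add, add_zero] at h
      linear_combination h - x 0 * h1
    | n + 2, ih, hn =>
      refine mul_left_cancel₀ (Complex.ofReal_ne_zero.mpr (hS.off_ne_zero hn)) ?_
      have h := hx (n + 1) hn
      have h1 := congrArg (Complex.ofReal) (off_mul_sol hS β hn)
      push_cast at h1
      rw [if_neg (by omega), Nat.add_sub_cancel, ih n (by omega) (by omega),
        ih (n + 1) (by omega) (by omega)] at h
      linear_combination h - x 0 * h1

/-- Eigenvectors of `B₀`, extended by zero to the last site, are multiples of the solution. -/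
theorem eq_mul_sol_of_B0_mulVec {S : RealSymbol k} (hS : S.Nondegenerate) {β : ℝ} (hk : 1 < k)
    {x : Fin k → ℂ} (hx : x (lastSite k) = 0)
    (h : S.B0.mulVec (fun j => x (innerSite j)) = fun j => (β : ℂ) * x (innerSite j)) (i : Fin k) :
    x i = x 0 * S.sol β i := by
  set X : ℕ → ℂ := fun n => x (Fin.ofNat k n) with hX
  have hXx : ∀ j : Fin k, X j = x j := fun j => by simp [hX]
  have hXlast : X (k - 1) = 0 := by rw [← hx, ← hXx]; rfl
  have key := eq_mul_sol hS (β := β) (x := X) (fun n hn => by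
    have h1 := congrFun h ⟨n, by omega⟩
    -- The point `z = 1` is arbitrary, since `x` vanishes at the last site.
    rw [← S.symbol_mulVec_innerSite 1 hx, show x = fun j : Fin k => X j from
      funext fun j => (hXx j).symm, symbol_mulVec_apply] at h1
    simp only [Fin.val_castLE] at h1
    rw [if_pos hn, if_neg (show ¬ n + 1 = k by omega), hXlast] at h1
    simpa using h1) i i.2
  rw [hXx] at key
  rw [key]
  rfl

/-- The solution within a cell as a vector. -/
def solVec (S : RealSymbol k) (β : ℝ) (i : Fin k) : ℂ := S.sol β i

theorem solVec_lastSite {S : RealSymbol k} {β : ℝ} (hβ : S.sol β (k - 1) = 0) :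
    S.solVec β (lastSite k) = 0 := by
  simp [solVec, lastSite, hβ]

theorem solVec_zero (S : RealSymbol k) (β : ℝ) : S.solVec β 0 = 1 := by
  simp [solVec]

/-- The recurrence settles every row but the last. The entry `z b_k` of the first row meets the zero
at the last site, whereas `z⁻¹ b_k` in the last row meets the initial value 1. -/
theorem symbol_mulVec_solVec {S : RealSymbol k} (hS : S.Nondegenerate) {β : ℝ} (hk : 1 < k)
    (hβ : S.sol β (k - 1) = 0) (z : ℂ) :
    (S.symbol z).mulVec (S.solVec β) = (β : ℂ) • S.solVec β +
      Pi.single (lastSite k) (S.innerCoupling β + z⁻¹ * S.outerCoupling) := by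
  ext i
  have h := S.symbol_mulVec_apply z (fun n => (S.sol β n : ℂ)) i
  change (S.symbol z).mulVec (S.solVec β) i = _ at h
  rw [h, hβ]
  have hi := i.2
  simp only [Pi.add_apply, Pi.smul_apply, smul_eq_mul, solVec, sol_zero]
  by_cases hl : (i : ℕ) + 1 = k
  · have hil : i = lastSite k := Fin.ext (by simp only [lastSite]; omega)
    rw [if_neg (by omega), if_neg (by omega), if_pos hl, if_neg (by omega), hil, Pi.single_eq_same,
      innerCoupling]
    simp only [lastSite, hβ, show k - 1 - 1 = k - 2 by omega]
    push_cast
    ring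
  · have hil : i ≠ lastSite k := fun e => hl (by rw [e]; simp only [lastSite]; omega)
    rw [if_pos (by omega), if_neg hl, Pi.single_eq_of_ne hil]
    rcases h0 : (i : ℕ) with _ | n
    · have h1 := congrArg (Complex.ofReal) (off_mul_sol_one hS β hk)
      push_cast at h1
      simp only [if_true, sol_zero]
      push_cast
      linear_combination h1
    · have h1 := congrArg (Complex.ofReal) (off_mul_sol hS β (n := n) (by omega))
      push_cast at h1
      rw [if_neg (by omega), if_neg (by omega), Nat.add_sub_cancel]
      linear_combination h1

/-! ### Sorted eigenvalues of the symbol and of `B₀` -/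

theorem isHermitian_B0 (S : RealSymbol k) : S.B0.IsHermitian := by
  ext i j
  rw [Matrix.conjTranspose_apply, ← S.symbol_innerSite (1 : Circle), ← S.symbol_innerSite
    (1 : Circle)]
  exact (S.symbol_isHermitian 1).apply _ _

/-- `B₀` as an operator on the Euclidean space. -/
def B0Op (S : RealSymbol k) :
    EuclideanSpace ℂ (Fin (k - 1)) →L[ℂ] EuclideanSpace ℂ (Fin (k - 1)) :=
  Matrix.toEuclideanCLM (𝕜 := ℂ) S.B0

theorem isSymmetric_B0Op (S : RealSymbol k) : (S.B0Op.toLinearMap).IsSymmetric := by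
  rw [B0Op, Matrix.coe_toEuclideanCLM_eq_toEuclideanLin]
  exact Matrix.isSymmetric_toEuclideanLin_iff.mpr S.isHermitian_B0

/-- The symbol at a point of the unit circle as an operator on the Euclidean space. -/
def symbolOp {k : ℕ} (S : RealSymbol k) (z : Circle) :
    EuclideanSpace ℂ (Fin k) →ₗ[ℂ] EuclideanSpace ℂ (Fin k) :=
  Matrix.toEuclideanLin (S.symbol z)

theorem isSymmetric_symbolOp {k : ℕ} (S : RealSymbol k) (z : Circle) : (S.symbolOp z).IsSymmetric :=
  Matrix.isSymmetric_toEuclideanLin_iff.mpr (S.symbol_isHermitian z)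

theorem symbolOp_apply {k : ℕ} (S : RealSymbol k) (z : Circle) (x : EuclideanSpace ℂ (Fin k))
    (i : Fin k) :
    S.symbolOp z x i = (S.symbol z).mulVec x.ofLp i := rfl

/-- The eigenvalues of `B₀` in decreasing order. -/
def cellEigenvalue (S : RealSymbol k) (i : Fin (k - 1)) : ℝ :=
  S.isSymmetric_B0Op.eigenvalues finrank_euclideanSpace_fin i

/-- The eigenvalues of the symbol at a point of the unit circle in decreasing order. -/
def symbolEigenvalue {k : ℕ} (S : RealSymbol k) (z : Circle) (i : Fin k) : ℝ :=
  (S.isSymmetric_symbolOp z).eigenvalues finrank_euclideanSpace_fin i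

/-- Mathlib sorts eigenvalues decreasingly and bands are numbered upwards, hence `rev`. -/
theorem bandFun_eq {k : ℕ} (S : RealSymbol k) (j : Fin k) (z : Circle) :
    S.bandFun j z = S.symbolEigenvalue z j.rev :=
  (S.isSymmetric_symbolOp z).eigenvalues_congr finrank_euclideanSpace finrank_euclideanSpace_fin
    (by simp)

theorem mem_spectrum_B0_iff (S : RealSymbol k) (lam : ℂ) :
    lam ∈ spectrum ℂ S.B0 ↔ ∃ i, lam = S.cellEigenvalue i := by
  have h : lam ∈ spectrum ℂ S.B0 ↔ Module.End.HasEigenvalue S.B0Op.toLinearMap lam := by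
    rw [Module.End.hasEigenvalue_iff_mem_spectrum, B0Op,
      Matrix.coe_toEuclideanCLM_eq_toEuclideanLin, Matrix.spectrum_toLpLin]
  rw [h]
  constructor
  · intro h
    obtain ⟨i, hi⟩ := S.isSymmetric_B0Op.exists_eigenvalues_eq finrank_euclideanSpace_fin h
    exact ⟨i, hi.symm⟩
  · rintro ⟨i, rfl⟩
    exact S.isSymmetric_B0Op.hasEigenvalue_eigenvalues finrank_euclideanSpace_fin i

/-- Extension by zero to the last site of the unit cell. -/
def extendZero : EuclideanSpace ℂ (Fin (k - 1)) →ₗᵢ[ℂ] EuclideanSpace ℂ (Fin k) where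
  toFun y := WithLp.toLp 2 fun i => if h : (i : ℕ) < k - 1 then y ⟨i, h⟩ else 0
  map_add' x y := by
    ext i
    simp only [PiLp.add_apply]
    split_ifs <;> simp
  map_smul' c x := by
    ext i
    simp only [PiLp.smul_apply, RingHom.id_apply]
    split_ifs <;> simp
  norm_map' y := by
    simp [EuclideanSpace.norm_eq, sum_innerSite, lastSite]

theorem extendZero_innerSite (y : EuclideanSpace ℂ (Fin (k - 1))) (i : Fin (k - 1)) :
    extendZero (k := k) y (innerSite i) = y i := by
  simp [extendZero]

theorem extendZero_lastSite (y : EuclideanSpace ℂ (Fin (k - 1))) :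
    extendZero (k := k) y (lastSite k) = 0 := by
  simp [extendZero, lastSite]

theorem inner_symbolOp_extendZero (S : RealSymbol k) (z : Circle)
    (y : EuclideanSpace ℂ (Fin (k - 1))) :
    ⟪S.symbolOp z (extendZero y), extendZero y⟫_ℂ = ⟪S.B0Op.toLinearMap y, y⟫_ℂ := by
  rw [PiLp.inner_apply, PiLp.inner_apply, sum_innerSite, extendZero_lastSite, inner_zero_right,
    add_zero]
  refine Finset.sum_congr rfl fun i _ => ?_
  rw [extendZero_innerSite, symbolOp_apply, S.symbol_mulVec_innerSite z (extendZero_lastSite y)]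
  simp only [extendZero_innerSite]
  rfl

/-- Cauchy interlacing. B₀ does not depend on `z`, so its eigenvalues separate whole bands and not
just the eigenvalues at one `z`. -/
theorem cellEigenvalue_le (S : RealSymbol k) (z : Circle) {i : Fin (k - 1)} {j : Fin k}
    (hij : (j : ℕ) ≤ i) : S.cellEigenvalue i ≤ S.symbolEigenvalue z j :=
  ((S.isSymmetric_symbolOp z).eigenvalues_compression_le S.isSymmetric_B0Op
    finrank_euclideanSpace_fin finrank_euclideanSpace_fin extendZero
    (S.inner_symbolOp_extendZero z) (j := innerSite i) rfl).trans
    (LinearMap.IsSymmetric.eigenvalues_antitone _ _ hij)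

theorem le_cellEigenvalue (S : RealSymbol k) (z : Circle) {i : Fin (k - 1)} {j : Fin k}
    (hij : (i : ℕ) < j) : S.symbolEigenvalue z j ≤ S.cellEigenvalue i := by
  have hi : (i : ℕ) + 1 < k := lt_of_le_of_lt hij j.2
  have h1 : S.symbolEigenvalue z ⟨i + 1, hi⟩ ≤ S.cellEigenvalue i :=
    (S.isSymmetric_symbolOp z).eigenvalues_le_compression S.isSymmetric_B0Op
      finrank_euclideanSpace_fin finrank_euclideanSpace_fin (by omega) extendZero
      (S.inner_symbolOp_extendZero z) rfl
  have h2 : (⟨i + 1, hi⟩ : Fin k) ≤ j := hij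
  exact (LinearMap.IsSymmetric.eigenvalues_antitone _ _ h2).trans h1

theorem continuous_cellEigenvalue {X : Type*} [TopologicalSpace X] {F : X → RealSymbol k}
    (ha : Continuous fun t => (F t).a) (hb : Continuous fun t => (F t).b) (i : Fin (k - 1)) :
    Continuous fun t => (F t).cellEigenvalue i := by
  have hB : Continuous fun t => (F t).B0 := by
    refine continuous_matrix fun m n => ?_
    simp only [B0, A0, Matrix.submatrix_apply, Matrix.of_apply]
    split_ifs <;> fun_prop
  let φ : Matrix (Fin (k - 1)) (Fin (k - 1)) ℂ →ₗ[ℂ]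
      (EuclideanSpace ℂ (Fin (k - 1)) →L[ℂ] EuclideanSpace ℂ (Fin (k - 1))) :=
    { toFun := Matrix.toEuclideanCLM (𝕜 := ℂ)
      map_add' := map_add _
      map_smul' := map_smul _ }
  have hT : Continuous fun t => (F t).B0Op := φ.continuous_of_finiteDimensional.comp hB
  refine continuous_iff_continuousAt.mpr fun t₀ => ?_
  rw [ContinuousAt, tendsto_iff_dist_tendsto_zero]
  refine squeeze_zero (fun _ => dist_nonneg) (fun t => ?_)
    (tendsto_iff_dist_tendsto_zero.mp hT.continuousAt)
  rw [Real.dist_eq, dist_eq_norm]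
  exact LinearMap.IsSymmetric.abs_eigenvalues_sub_le _ _ _ _

theorem eq_smul_solVec_of_B0Op {S : RealSymbol k} (hS : S.Nondegenerate) {β : ℝ} (hk : 1 < k)
    {y : EuclideanSpace ℂ (Fin (k - 1))} (hy : S.B0Op y = (β : ℂ) • y) (i : Fin k) :
    extendZero (k := k) y i = extendZero (k := k) y 0 * S.sol β i := by
  refine eq_mul_sol_of_B0_mulVec hS hk (extendZero_lastSite y) ?_ i
  ext j
  have h := congrArg (fun v : EuclideanSpace ℂ (Fin (k - 1)) => v j) hy
  simp only [extendZero_innerSite]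
  exact h

/-- An eigenvector of B₀ extended by zero is a nonzero multiple of `sol`, and its last entry is 0.
-/
theorem sol_cellEigenvalue {S : RealSymbol k} (hS : S.Nondegenerate) (i : Fin (k - 1)) :
    S.sol (S.cellEigenvalue i) (k - 1) = 0 := by
  have hk : 1 < k := by have := i.2; omega
  obtain ⟨y, hy⟩ := (S.isSymmetric_B0Op.hasEigenvalue_eigenvalues
    finrank_euclideanSpace_fin i).exists_hasEigenvector
  have key := eq_smul_solVec_of_B0Op hS hk (Module.End.mem_eigenspace_iff.mp hy.1)
  by_contra hne
  have h0 : extendZero (k := k) y 0 = 0 := by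
    have h := key (lastSite k)
    rw [extendZero_lastSite, zero_eq_mul] at h
    exact h.resolve_right (Complex.ofReal_ne_zero.mpr hne)
  refine hy.2 ((extendZero (k := k)).injective ?_)
  ext j
  rw [key j, h0, zero_mul, map_zero]
  rfl

/-- An eigenvector of B₀ is determined by its first entry, so every eigenspace is at most a line. -/
theorem cellEigenvalue_strictAnti {S : RealSymbol k} (hS : S.Nondegenerate) :
    StrictAnti S.cellEigenvalue := by
  refine (LinearMap.IsSymmetric.eigenvalues_antitone _ _).strictAnti_of_injective
    fun i j hij => ?_
  have hk : 1 < k := by have := i.2; omega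
  have hcard := S.isSymmetric_B0Op.card_filter_eigenvalues_eq finrank_euclideanSpace_fin
    (S.cellEigenvalue i)
  have hle : finrank ℂ (Module.End.eigenspace S.B0Op.toLinearMap (S.cellEigenvalue i : ℂ)) ≤ 1 := by
    let φ : Module.End.eigenspace S.B0Op.toLinearMap (S.cellEigenvalue i : ℂ) →ₗ[ℂ] ℂ :=
      (EuclideanSpace.proj (𝕜 := ℂ) (0 : Fin k)).toLinearMap ∘ₗ
        (extendZero (k := k)).toLinearMap ∘ₗ Submodule.subtype _
    refine (LinearMap.finrank_le_finrank_of_injective (f := φ)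
      ((injective_iff_map_eq_zero _).mpr fun y hy => ?_)).trans (finrank_self ℂ).le
    have key := eq_smul_solVec_of_B0Op hS hk (Module.End.mem_eigenspace_iff.mp y.2)
    have h0 : extendZero (k := k) (y : EuclideanSpace ℂ (Fin (k - 1))) 0 = 0 := hy
    refine Subtype.ext ((extendZero (k := k)).injective ?_)
    ext j
    rw [key j, h0, zero_mul, ZeroMemClass.coe_zero, map_zero]
    rfl
  rw [← hcard, Finset.card_le_one] at hle
  exact hle i (by simp [cellEigenvalue]) j (by
    rw [Finset.mem_filter]
    exact ⟨Finset.mem_univ _, congrArg _ hij.symm⟩)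

/-! ### Contact of an eigenvalue of `B₀` with a band -/

theorem hasEigenvalue_symbolEigenvalue {k : ℕ} (S : RealSymbol k) (z : Circle) (m : Fin k) :
    Module.End.HasEigenvalue (S.symbolOp z) (S.symbolEigenvalue z m : ℂ) :=
  (S.isSymmetric_symbolOp z).hasEigenvalue_eigenvalues finrank_euclideanSpace_fin m

theorem symbolOp_solVec {S : RealSymbol k} (hS : S.Nondegenerate) {β : ℝ} (hk : 1 < k)
    (hβ : S.sol β (k - 1) = 0) (z : Circle) :
    S.symbolOp z (WithLp.toLp 2 (S.solVec β)) = (β : ℂ) • WithLp.toLp 2 (S.solVec β) +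
      EuclideanSpace.single (lastSite k)
        (S.innerCoupling β + (z : ℂ)⁻¹ * S.outerCoupling) := by
  ext i
  exact congrFun (symbol_mulVec_solVec hS hk hβ z) i

/-- If an eigenvalue of `B₀` is also one of `f(z)`, then the couplings balance at `z`. -/
theorem coupling_eq_zero_of_hasEigenvalue {S : RealSymbol k} (hS : S.Nondegenerate) {β : ℝ}
    (hk : 1 < k) (hβ : S.sol β (k - 1) = 0) {z : Circle}
    (h : Module.End.HasEigenvalue (S.symbolOp z) (β : ℂ)) :
    S.innerCoupling β + (z : ℂ)⁻¹ * S.outerCoupling = 0 := by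
  obtain ⟨x, hx⟩ := h.exists_hasEigenvector
  have hx1 : S.symbolOp z x = (β : ℂ) • x := Module.End.mem_eigenspace_iff.mp hx.1
  have hu := symbolOp_solVec hS hk hβ z
  -- Pairing the eigenvector with u leaves (α + γ/z) times the conjugate of its last entry, and this
  -- must vanish. If the last entry is 0, the eigenvector is itself a multiple of u, and its last
  -- row gives α + γ/z = 0 after all.
  have hsymm := S.isSymmetric_symbolOp z x (WithLp.toLp 2 (S.solVec β))
  rw [hx1, hu, inner_add_right, inner_smul_left, inner_smul_right, Complex.conj_ofReal,
    left_eq_add, EuclideanSpace.inner_single_right, mul_eq_zero] at hsymm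
  by_contra hc
  have hlast := hsymm.resolve_left hc
  have hxlast : x (lastSite k) = 0 := by simpa using hlast
  have hxv : (S.symbol z).mulVec x.ofLp = (β : ℂ) • x.ofLp := congrArg WithLp.ofLp hx1
  have hxu := eq_mul_sol_of_B0_mulVec hS (β := β) hk hxlast (by
    ext i
    rw [← S.symbol_mulVec_innerSite z hxlast, hxv]
    rfl)
  have hx0 : x 0 ≠ 0 := fun h0 => hx.2 (by
    ext i
    rw [hxu, h0, zero_mul]
    rfl)
  have hxs : x.ofLp = x 0 • S.solVec β := funext hxu
  rw [hxs, Matrix.mulVec_smul, symbol_mulVec_solVec hS hk hβ] at hxv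
  have h1 := congrFun hxv (lastSite k)
  exact hc (by simpa [solVec_lastSite hβ, hx0] using h1)

/-- On the circle the transpose of f(z) is its entrywise conjugate, so it has the same real
eigenvectors for real eigenvalues; conjugating by J reverses them. -/
theorem persymmetric_mulVec {k : ℕ} {S : RealSymbol k} (hP : S.Persymmetric) {z : Circle}
    {u : Fin k → ℂ} {β : ℝ} (hu : ∀ i, (starRingEnd ℂ) (u i) = u i)
    (h : (S.symbol z).mulVec u = (β : ℂ) • u) :
    (S.symbol z).mulVec (fun i => u i.rev) = (β : ℂ) • fun i => u i.rev := by
  have hJ : ∀ v : Fin k → ℂ, (exchange k).mulVec v = fun i => v i.rev := fun v => by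
    ext i
    simp [exchange, Matrix.mulVec, dotProduct]
  have hT : (S.symbol z).transpose.mulVec u = (β : ℂ) • u := by
    ext i
    have h1 := congrArg (starRingEnd ℂ) (congrFun h i)
    simp only [Matrix.mulVec, dotProduct, map_sum, map_mul, hu, Pi.smul_apply, smul_eq_mul,
      Complex.conj_ofReal] at h1 ⊢
    rw [← h1]
    refine Finset.sum_congr rfl fun j _ => ?_
    rw [Matrix.transpose_apply, ← (S.symbol_isHermitian z).apply j i]
    rfl
  have hJu : (exchange k).mulVec (fun i => u i.rev) = u := by
    rw [hJ]
    simp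
  rw [hP z (Circle.coe_ne_zero z), ← Matrix.mulVec_mulVec, ← Matrix.mulVec_mulVec, hJu, hT, hJ]
  rfl

/-- By persymmetry, balanced couplings give a double eigenvalue of the symbol. -/
theorem two_le_finrank_eigenspace {S : RealSymbol k} (hS : S.Nondegenerate) (hP : S.Persymmetric)
    {β : ℝ} (hk : 1 < k) (hβ : S.sol β (k - 1) = 0) {z : Circle}
    (hc : S.innerCoupling β + (z : ℂ)⁻¹ * S.outerCoupling = 0) :
    2 ≤ finrank ℂ (Module.End.eigenspace (S.symbolOp z) (β : ℂ)) := by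
  have h1 : (S.symbol z).mulVec (S.solVec β) = (β : ℂ) • S.solVec β := by
    rw [symbol_mulVec_solVec hS hk hβ, hc, Pi.single_zero, add_zero]
  have h2 := persymmetric_mulVec hP (fun i => Complex.conj_ofReal _) h1
  let v : Fin 2 → Module.End.eigenspace (S.symbolOp z) (β : ℂ) :=
    ![⟨WithLp.toLp 2 (S.solVec β), Module.End.mem_eigenspace_iff.mpr (congrArg (WithLp.toLp 2) h1)⟩,
      ⟨WithLp.toLp 2 fun i => S.solVec β i.rev,
        Module.End.mem_eigenspace_iff.mpr (congrArg (WithLp.toLp 2) h2)⟩]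
  have hrev : (0 : Fin k).rev = lastSite k := Fin.ext (by simp [lastSite, Fin.val_rev])
  have hrev' : (lastSite k).rev = 0 := by rw [← hrev, Fin.rev_rev]
  -- u is 1 at the first site and 0 at the last, its reversal the other way round.
  have hli : LinearIndependent ℂ v := by
    rw [LinearIndependent.pair_iff]
    intro s t hst
    have hst' : ∀ i, s * S.solVec β i + t * S.solVec β i.rev = 0 := fun i =>
      congrArg (fun w : Module.End.eigenspace (S.symbolOp z) (β : ℂ) =>
        (w : EuclideanSpace ℂ (Fin k)) i) hst
    have h0 := hst' 0
    have hl := hst' (lastSite k)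
    rw [hrev, solVec_lastSite hβ, solVec_zero] at h0
    rw [hrev', solVec_lastSite hβ, solVec_zero] at hl
    exact ⟨by simpa using h0, by simpa using hl⟩
  simpa using hli.fintype_card_le_finrank

theorem abs_innerCoupling_eq_of_hasEigenvalue {S : RealSymbol k} (hS : S.Nondegenerate) {β : ℝ}
    (hk : 1 < k) (hβ : S.sol β (k - 1) = 0) {z : Circle}
    (h : Module.End.HasEigenvalue (S.symbolOp z) (β : ℂ)) :
    |S.innerCoupling β| = |S.outerCoupling| := by
  have h1 := congrArg norm (eq_neg_of_add_eq_zero_left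
    (coupling_eq_zero_of_hasEigenvalue hS hk hβ h))
  rwa [norm_neg, norm_mul, norm_inv, Circle.norm_coe, inv_one, one_mul, Complex.norm_real,
    Complex.norm_real, Real.norm_eq_abs, Real.norm_eq_abs] at h1

/-- An eigenvalue of `B₀` touching an adjacent band closes the gap. -/
theorem symbolEigenvalue_eq_of_contact {S : RealSymbol k} (hS : S.Nondegenerate)
    (hP : S.Persymmetric) (i : Fin (k - 1)) {z : Circle}
    (h : Module.End.HasEigenvalue (S.symbolOp z) (S.cellEigenvalue i : ℂ)) {m : Fin k}
    (hm : (m : ℕ) = i ∨ (m : ℕ) = i + 1) : S.symbolEigenvalue z m = S.cellEigenvalue i := by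
  have hi := i.2
  have hk : 1 < k := by omega
  have hβ := sol_cellEigenvalue hS i
  have h2 := two_le_finrank_eigenspace hS hP hk hβ
    (coupling_eq_zero_of_hasEigenvalue hS hk hβ h)
  rw [← (S.isSymmetric_symbolOp z).card_filter_eigenvalues_eq finrank_euclideanSpace_fin] at h2
  -- Strict interlacing away from the two neighbours leaves only the indices `i` and `i + 1`;
  -- multiplicity two then requires both.
  have hsub : (Finset.univ.filter fun m => ((S.isSymmetric_symbolOp z).eigenvalues
      finrank_euclideanSpace_fin m : ℂ) = (S.cellEigenvalue i : ℂ)) ⊆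
      {⟨i, by omega⟩, ⟨i + 1, by omega⟩} := by
    intro m hm
    have hme : S.symbolEigenvalue z m = S.cellEigenvalue i :=
      Complex.ofReal_injective (Finset.mem_filter.mp hm).2
    have hm2 := m.2
    simp only [Finset.mem_insert, Finset.mem_singleton, Fin.ext_iff]
    by_contra hne
    rcases (show (m : ℕ) < i ∨ (i : ℕ) + 1 < m by omega) with hlt | hlt
    · have h3 := S.cellEigenvalue_le z (i := ⟨m, by omega⟩) (j := m) le_rfl
      have h4 := cellEigenvalue_strictAnti hS (a := ⟨m, by omega⟩) (b := i) hlt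
      linarith
    · have h3 := S.le_cellEigenvalue z (i := ⟨m - 1, by omega⟩) (j := m)
        (show (m : ℕ) - 1 < m by omega)
      have h4 := cellEigenvalue_strictAnti hS (a := i) (b := ⟨m - 1, by omega⟩)
        (show (i : ℕ) < m - 1 by omega)
      linarith
  have heq := Finset.eq_of_subset_of_card_le hsub (Finset.card_le_two.trans h2)
  have hmem : m ∈ ({⟨i, by omega⟩, ⟨i + 1, by omega⟩} : Finset (Fin k)) := by
    simpa [Fin.ext_iff] using hm
  rw [← heq] at hmem
  exact Complex.ofReal_injective (Finset.mem_filter.mp hmem).2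

end RealSymbol

end TriToeplitz

/-! ### Stability along a deformation. -/

namespace TriToeplitz

namespace RealSymbol

open Module

variable {k : ℕ} [NeZero k]

/-- If the `j`-th gap is open, then the corresponding eigenvalue of `B₀` lies in it. -/
theorem cellEigenvalue_mem_gap {S : RealSymbol k} (i : Fin (k - 1)) {j : ℕ}
    (hj : j + 1 < k) (hij : (i : ℕ) + j + 2 = k)
    (h : ∀ z, ¬ Module.End.HasEigenvalue (S.symbolOp z) (S.cellEigenvalue i : ℂ)) :
    S.cellEigenvalue i ∈ S.gap j hj := by
  intro z w
  rw [bandFun_eq, bandFun_eq]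
  -- Interlacing gives the weak inequalities; equality would make β an eigenvalue of the symbol.
  refine ⟨lt_of_le_of_ne (S.le_cellEigenvalue z ?_) fun e => h z ?_,
    lt_of_le_of_ne (S.cellEigenvalue_le w ?_) fun e => h w ?_⟩
  · simp only [Fin.val_rev]; omega
  · rw [← e]; exact S.hasEigenvalue_symbolEigenvalue z _
  · simp only [Fin.val_rev]; omega
  · rw [e]; exact S.hasEigenvalue_symbolEigenvalue w _

/-- Contact at `z` makes both neighbouring band functions equal there, leaving no room for a point
of the gap. -/
theorem not_hasEigenvalue_of_gap_nonempty {S : RealSymbol k} (hS : S.Nondegenerate)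
    (hP : S.Persymmetric) (i : Fin (k - 1)) {j : ℕ} (hj : j + 1 < k) (hij : (i : ℕ) + j + 2 = k)
    (hgap : (S.gap j hj).Nonempty) (z : Circle) :
    ¬ Module.End.HasEigenvalue (S.symbolOp z) (S.cellEigenvalue i : ℂ) := by
  intro h
  obtain ⟨x, hx⟩ := hgap
  obtain ⟨h1, h2⟩ := hx z z
  rw [bandFun_eq] at h1 h2
  rw [symbolEigenvalue_eq_of_contact hS hP i h (Or.inr (by simp only [Fin.val_rev]; omega))] at h1
  rw [symbolEigenvalue_eq_of_contact hS hP i h (Or.inl (by simp only [Fin.val_rev]; omega))] at h2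
  exact lt_asymm h1 h2

/-- Equally strong couplings make an eigenvalue of `B₀` an eigenvalue of the symbol. -/
theorem exists_hasEigenvalue_of_abs_eq {S : RealSymbol k} (hS : S.Nondegenerate) {β : ℝ}
    (hk : 1 < k) (hβ : S.sol β (k - 1) = 0) (h : |S.innerCoupling β| = |S.outerCoupling|) :
    ∃ z, Module.End.HasEigenvalue (S.symbolOp z) (β : ℂ) := by
  have key : ∀ z : Circle, S.innerCoupling β + (z : ℂ)⁻¹ * S.outerCoupling = 0 →
      Module.End.HasEigenvalue (S.symbolOp z) (β : ℂ) := fun z hz => by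
    refine Module.End.hasEigenvalue_of_hasEigenvector (x := WithLp.toLp 2 (S.solVec β))
      ⟨Module.End.mem_eigenspace_iff.mpr ?_, fun h0 => ?_⟩
    · ext i
      rw [symbolOp_solVec hS hk hβ, hz]
      simp
    · have h1 := congrArg (fun v : EuclideanSpace ℂ (Fin k) => v 0) h0
      exact one_ne_zero ((S.solVec_zero β).symm.trans h1)
  -- α and γ are real, so the balancing point is `z = -1` or `z = 1`.
  rcases abs_eq_abs.mp h with h | h
  · exact ⟨-1, key _ (by rw [h]; simp [inv_neg])⟩
  · exact ⟨1, key _ (by rw [h]; simp)⟩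

theorem continuous_sol {X : Type*} [TopologicalSpace X] {F : X → RealSymbol k}
    (ha : Continuous fun t => (F t).a) (hb : Continuous fun t => (F t).b)
    (hF : ∀ t, (F t).Nondegenerate) {β : X → ℝ} (hβ : Continuous β) (n : ℕ) (hn : n < k) :
    Continuous fun t => (F t).sol (β t) n := by
  have hd : ∀ n, Continuous fun t => (F t).diag n := fun n => (continuous_apply _).comp ha
  have ho : ∀ n, Continuous fun t => (F t).off n := fun n => (continuous_apply _).comp hb
  induction n using Nat.strong_induction_on with
  | _ n ih =>
    match n, ih, hn with
    | 0, _, _ => simpa using continuous_const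
    | 1, _, hn =>
      simp only [sol]
      exact (hβ.sub (hd 0)).div (ho 0) fun t => (hF t).off_ne_zero hn
    | n + 2, ih, hn =>
      simp only [sol]
      exact (((hβ.sub (hd (n + 1))).mul (ih (n + 1) (by omega) (by omega))).sub
        ((ho n).mul (ih n (by omega) (by omega)))).div (ho (n + 1))
        fun t => (hF t).off_ne_zero hn

/-- Along a path of symbols whose couplings never balance, the dominant one stays dominant. -/
theorem lt_iff_lt_of_forall_ne {f g : unitInterval → ℝ} (hf : Continuous f) (hg : Continuous g)
    (h : ∀ t, f t ≠ g t) (s t : unitInterval) : f s < g s ↔ f t < g t := by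
  have key : ∀ s t, f s < g s → f t < g t := fun s t hs => by
    by_contra ht
    obtain ⟨r, hr⟩ := intermediate_value_univ₂ hf hg hs.le (not_lt.mp ht)
    exact h r hr
  exact ⟨key s t, key t s⟩

/-- A continuous selection from finitely many continuous functions with distinct values agrees with
a single one of them. -/
theorem eq_of_continuous_selection {ι : Type*} [Finite ι] {X Y : Type*} [TopologicalSpace X]
    [PreconnectedSpace X] [TopologicalSpace Y] [T2Space Y] {f : ι → X → Y}
    (hf : ∀ i, Continuous (f i)) (hinj : ∀ t, Function.Injective fun i => f i t) {ν : X → Y}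
    (hν : Continuous ν) (hsel : ∀ t, ∃ i, ν t = f i t) {i : ι} {t₀ : X} (h0 : ν t₀ = f i t₀) :
    ν = f i := by
  have hclosed : ∀ j, IsClosed {t | ν t = f j t} := fun j => isClosed_eq hν (hf j)
  have hcompl : {t | ν t = f i t}ᶜ = ⋃ j : {j // j ≠ i}, {t | ν t = f j t} := by
    ext t
    simp only [Set.mem_compl_iff, Set.mem_ofPred_eq, Set.mem_iUnion]
    constructor
    · intro ht
      obtain ⟨j, hj⟩ := hsel t
      exact ⟨⟨j, fun e => ht (e ▸ hj)⟩, hj⟩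
    · rintro ⟨⟨j, hji⟩, hj⟩ ht
      exact hji (hinj t (hj.symm.trans ht))
  have hopen : IsOpen {t | ν t = f i t} := by
    rw [← isClosed_compl_iff, hcompl]
    exact isClosed_iUnion_of_finite fun j => hclosed j
  have huniv := IsClopen.eq_univ ⟨hclosed i, hopen⟩ ⟨t₀, h0⟩
  exact funext fun t => Set.eq_univ_iff_forall.mp huniv t

theorem topologicallyProtected {S : RealSymbol k} (hS : S.Nondegenerate) {lam : ℂ}
    (hlam : lam ∈ spectrum ℂ S.B0 \ S.essSpectrum) : S.TopologicallyProtected lam := by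
  obtain ⟨i, rfl⟩ := (S.mem_spectrum_B0_iff lam).mp hlam.1
  have hi := i.2
  have hk : 1 < k := by omega
  have hj : (k - 2 - i : ℕ) + 1 < k := by omega
  have hij : (i : ℕ) + (k - 2 - i) + 2 = k := by omega
  have hfred : (S.shifted (S.cellEigenvalue i)).IsFredholm := not_not.mp hlam.2
  -- The `i`-th eigenvalue from the top is number `k - 2 - i` from the bottom, counted from 0 like
  -- the gaps. Contact with a band would give |α| = |γ|, contradicting Fredholmness.
  refine ⟨k - 2 - i, hj, ⟨_, cellEigenvalue_mem_gap i hj hij fun z hz => ?_, rfl⟩, ?_⟩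
  · exact not_isFredholm_shifted hS hk (sol_cellEigenvalue hS i)
      (abs_innerCoupling_eq_of_hasEigenvalue hS hk (sol_cellEigenvalue hS i) hz) hfred
  intro F ha hb h0 hF hP hgap
  subst h0
  have hsol := fun t => sol_cellEigenvalue (hF t) i
  have hnoeig := fun t => not_hasEigenvalue_of_gap_nonempty (hF t) (hP t) i hj hij (hgap t)
  have hne : ∀ t, |(F t).innerCoupling ((F t).cellEigenvalue i)| ≠ |(F t).outerCoupling| :=
    fun t h => by
      obtain ⟨z, hz⟩ := exists_hasEigenvalue_of_abs_eq (hF t) hk (hsol t) h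
      exact hnoeig t z hz
  have hβ : ∀ i, Continuous fun t => (F t).cellEigenvalue i := continuous_cellEigenvalue ha hb
  have hoff : ∀ n, Continuous fun t => (F t).off n := fun n => (continuous_apply _).comp hb
  have hinner : Continuous fun t => |(F t).innerCoupling ((F t).cellEigenvalue i)| :=
    ((hoff _).mul (continuous_sol ha hb hF (hβ i) (k - 2) (by omega))).abs
  have houter : Continuous fun t => |(F t).outerCoupling| := (hoff _).abs
  refine ⟨⟨fun t => ((F t).cellEigenvalue i : ℂ), Complex.continuous_ofReal.comp (hβ i)⟩, rfl,
    fun t => ⟨⟨((F t).mem_spectrum_B0_iff _).mpr ⟨i, rfl⟩, not_not.mpr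
      (isFredholm_shifted (hF t) hk (hsol t) (hne t))⟩,
      ⟨_, cellEigenvalue_mem_gap i hj hij (hnoeig t), rfl⟩, ?_⟩, fun ν hν0 hν => ?_⟩
  · rw [ContinuousMap.coe_mk, isEdgeEigenvalue_iff (hF t) hk (hsol t) (hne t),
      isEdgeEigenvalue_iff (hF 0) hk (hsol 0) (hne 0)]
    exact lt_iff_lt_of_forall_ne hinner houter hne t 0
  -- A competing path selects among the eigenvalue branches, which never cross, so it stays on
  -- branch `i`.
  · refine ContinuousMap.coe_injective (eq_of_continuous_selection
      (f := fun i t => ((F t).cellEigenvalue i : ℂ))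
      (fun i => Complex.continuous_ofReal.comp (hβ i)) (fun t => ?_) ν.continuous
      (fun t => ((F t).mem_spectrum_B0_iff _).mp (hν t)) hν0)
    exact Complex.ofReal_injective.comp (cellEigenvalue_strictAnti (hF t)).injective

end RealSymbol

end TriToeplitz

end

theorem mainTheorem4 (k : ℕ) [NeZero k] (S : TriToeplitz.RealSymbol k)
    (hnd : S.Nondegenerate) (hS : S.Persymmetric) (lam : ℂ)
    (hlam : lam ∈ spectrum ℂ S.B0 \ S.essSpectrum) :
    S.TopologicallyProtected lam :=
  TriToeplitz.RealSymbol.topologicallyProtected hnd hlam
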